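/- All functions live on $(0,\infty)$. For $k\ge 0$ let $L^1_k$ be the space of (classes of) functions $g$ with $\|g\|_{L^1_k}=\int_0^\infty |g(x)|(1+x)^k\,dx<\infty$. Put $$\mathcal C(g,g)(x)=\int_0^x g(x-y)g(y)\,dy-2g(x)\int_0^\infty g(y)\,dy,\qquad (S_th)(x)=e^{2t}h(e^tx).$$ A (mild) solution, with initial condition $f_0\in L^1_k$, of Smoluchowski's equation in self-similar variables with constant kernel $K=2$, $$\partial_t f=\mathcal C(f,f)+2f+x\,\partial_xf,$$ is a function $f\in C([0,\infty);L^1_k)$ such that $f(t)=S_tf_0+\int_0^tS_{t-s}\,\mathcal C(f(s),f(s))\,ds$ for all $t\ge0$ (Bochner integral in $L^1_k$). **Theorem.** (i) The function $G^0(x)=e^{-x}$ is the unique nonnegative stationary solution $G\in L^1_1$ of this equation (that is, the constant curve $t\mapsto G$ is a solution in $C([0,\infty);L^1_1)$) with total mass $\int_0^\infty xG(x)\,dx=1$. (ii) There is a function $C=C(a,b)>0$ of $a,b\ge 0$, nondecreasing in each variable and explicit, in the sense that it is given by a closed formula built from $a$, $b$ and rational numbers by addition, multiplication, inversion, maximum,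 exponential and logarithm, with the following property. Let $k\ge0$ and let $f\in C([0,\infty);L^1_k)$ be a solution whose initial condition $f_0$ is nonnegative, has total mass $\int_0^\infty xf_0(x)\,dx=1$ and satisfies $f_0\in L^2(dx)\cap L^1(x^2\,dx)$. Then $$\|f(t,\cdot)-G^0\|_{L^2(0,\infty)}\le C\bigl(\|f_0\|_{L^2},\|f_0\|_{L^1_2}\bigr)\,e^{-t/2}\qquad\text{for all }t\ge0.$$ -/

import Mathlib

open MeasureTheory Set

noncomputable section

/-- Lebesgue measure on the half line `(0, ∞)`. -/
def halfLine : Measure ℝ := volume.restrict (Ioi 0)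

/-- The measure `(1 + x)^k dx` on `(0, ∞)`. -/
def weightMeasure (k : ℝ) : Measure ℝ :=
  halfLine.withDensity (fun x => ENNReal.ofReal ((1 + x) ^ k))

/-- The Banach space `L¹_k = L¹((0, ∞), (1 + x)^k dx)`. -/
abbrev WeightedL1 (k : ℝ) : Type := Lp ℝ 1 (weightMeasure k)

/-- The coagulation operator with kernel `K`:
`C_K(g,g)(x) = ½ ∫₀ˣ K(x-y,y) g(x-y) g(y) dy - g(x) ∫₀^∞ K(x,y) g(y) dy`. -/
def coagulation (K : ℝ → ℝ → ℝ) (g : ℝ → ℝ) (x : ℝ) : ℝ :=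
  (1 / 2) * (∫ y in (0 : ℝ)..x, K (x - y) y * g (x - y) * g y)
    - g x * ∫ y in Ioi (0 : ℝ), K x y * g y

/-- The semigroup generated by `h ↦ 2 h + x h'`, that is `(S_t h)(x) = e^{2t} h(e^t x)`. -/
def dilation (t : ℝ) (h : ℝ → ℝ) (x : ℝ) : ℝ :=
  Real.exp (2 * t) * h (Real.exp t * x)

/-- Mild solutions in `C([0, ∞), L¹_k)`, with initial datum `f₀`, of the Smoluchowski equation in
self-similar variables `∂ₜ f = C_K(f,f) + 2 f + x ∂ₓ f`:
`f(t) = S_t f₀ + ∫₀ᵗ S_{t-s} C_K(f(s),f(s)) ds` for all `t ≥ 0`, where the integral is the Bochner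
integral in `L¹_k` of the curve `Φ`, `Φ s` being the class of `S_{t-s} C_K(f(s),f(s))`. -/
structure IsMildSolution (K : ℝ → ℝ → ℝ) {k : ℝ} (f₀ : WeightedL1 k) (f : ℝ → WeightedL1 k) :
    Prop where
  continuousOn : ContinuousOn f (Ici 0)
  duhamel : ∀ t : ℝ, 0 ≤ t → ∃ Φ : ℝ → WeightedL1 k,
    (∀ s ∈ Icc 0 t, Φ s =ᵐ[halfLine] dilation (t - s) (coagulation K (f s))) ∧
    IntervalIntegrable Φ volume 0 t ∧
    f t =ᵐ[halfLine] fun x => dilation t f₀ x + (∫ s in (0 : ℝ)..t, Φ s : WeightedL1 k) x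

/-- Self-similar profiles: time-independent mild solutions in `L¹_1`. -/
def IsProfile (K : ℝ → ℝ → ℝ) (G : WeightedL1 1) : Prop :=
  IsMildSolution K G (fun _ => G)

/-- Nonnegative almost everywhere on `(0, ∞)`, with total mass `∫₀^∞ x g(x) dx` equal to one. -/
def IsUnitMassDensity (g : ℝ → ℝ) : Prop :=
  (∀ᵐ x ∂halfLine, 0 ≤ g x) ∧ Integrable (fun x => x * g x) halfLine ∧
    ∫ x, x * g x ∂halfLine = 1

/-- The norm `‖g‖_{L²(0,∞)}`, for `g ∈ L²(0,∞)`. -/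
def normL2 (g : ℝ → ℝ) : ℝ := (eLpNorm g 2 halfLine).toReal

/-- The norm `‖g‖_{L¹_k} = ∫₀^∞ |g(x)| (1 + x)^k dx`, for `g ∈ L¹_k`. -/
def normL1 (k : ℝ) (g : ℝ → ℝ) : ℝ := ∫ x, |g x| * (1 + x) ^ k ∂halfLine

/-- Closed formulas in two variables `a` and `b`, built from rational numbers by means of
addition, multiplication, inversion, maximum, exponential and logarithm. They make precise what
an explicit constant depending on two quantities is. -/
inductive ExplicitFormula : Type
  | a : ExplicitFormula
  | b : ExplicitFormula
  | const (q : ℚ) : ExplicitFormula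
  | add (u v : ExplicitFormula) : ExplicitFormula
  | mul (u v : ExplicitFormula) : ExplicitFormula
  | inv (u : ExplicitFormula) : ExplicitFormula
  | max (u v : ExplicitFormula) : ExplicitFormula
  | exp (u : ExplicitFormula) : ExplicitFormula
  | log (u : ExplicitFormula) : ExplicitFormula

/-- The value of a closed formula at `a = A` and `b = B`. -/
def ExplicitFormula.eval (A B : ℝ) : ExplicitFormula → ℝ
  | .a => A
  | .b => B
  | .const q => (q : ℝ)
  | .add u v => u.eval A B + v.eval A B
  | .mul u v => u.eval A B * v.eval A B
  | .inv u => (u.eval A B)⁻¹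
  | .max u v => Max.max (u.eval A B) (v.eval A B)
  | .exp u => Real.exp (u.eval A B)
  | .log u => Real.log (u.eval A B)

end


/-
On the half line the Fourier transform turns coagulation with kernel `2` into multiplication.
Along the characteristics `t ↦ e^t η`, both the value of the transform at `0` and its deficit
`f̂(0) - f̂(η)` then solve the logistic equation `y' = y - y²`, which gives the transform of `f(t)`
explicitly. As `t → ∞` only the transform `1 / (1 + iξ)` of `e^{-x}` survives, hence uniqueness.

For the rate, Plancherel's theorem turns a pointwise bound of order `e^{-t}` at `e^t η` into an
`L²` bound of order `e^{-t/2}`. For small `η` the pointwise bound follows from a Taylor expansion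
of the deficit, by means of the second moment of `f₀`. For the other `η` the real part
`∫ (1 - cos (ηx)) f₀(x) dx` of the deficit must stay away from zero, and it does because a density
in `L²` cannot concentrate near the zeros of `1 - cos (ηx)`.
-/

open Filter Topology
open scoped FourierTransform SchwartzMap ContDiff

section Plancherel

variable {E F : Type*} [NormedAddCommGroup E] [InnerProductSpace ℝ E] [FiniteDimensional ℝ E]
  [MeasurableSpace E] [BorelSpace E] [NormedAddCommGroup F]

section NormedSpace

variable [NormedSpace ℂ F] {g h : E → F}

theorem continuous_fourier_of_integrable (hg : Integrable g) : Continuous (𝓕 g) :=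
  VectorFourier.fourierIntegral_continuous Real.continuous_fourierChar
    (L := innerₗ E) continuous_inner hg

theorem integral_fourier_schwartz_smul [CompleteSpace F] (hg : Integrable g) (φ : 𝓢(E, ℂ)) :
    ∫ x, 𝓕 φ x • g x = ∫ x, φ x • 𝓕 g x := by
  simpa using! VectorFourier.integral_fourierIntegral_smul_eq_flip (L := innerₗ E)
    Real.continuous_fourierChar continuous_inner φ.integrable hg

theorem ae_eq_of_integral_schwartz_smul_eq [CompleteSpace F] (hg : LocallyIntegrable g)
    (hh : LocallyIntegrable h) (H : ∀ φ : 𝓢(E, ℂ), ∫ x, φ x • g x = ∫ x, φ x • h x) :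
    g =ᵐ[volume] h := by
  refine ae_eq_of_integral_contDiff_smul_eq hg hh fun φ hφ hc => ?_
  have hc' : HasCompactSupport fun x => (φ x : ℂ) := hc.comp_left (g := ((↑) : ℝ → ℂ)) (by simp)
  simpa using! H (hc'.toSchwartzMap (Complex.ofRealCLM.contDiff.comp hφ))

end NormedSpace

variable [InnerProductSpace ℂ F] [CompleteSpace F] {g : E → F}

theorem fourier_toLp_ae_eq (hg : Integrable g) (hg₂ : MemLp g 2) :
    (𝓕 (hg₂.toLp g) : Lp F 2 (volume : Measure E)) =ᵐ[volume] 𝓕 g := by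
  refine ae_eq_of_integral_schwartz_smul_eq ((Lp.memLp _).locallyIntegrable one_le_two)
    (continuous_fourier_of_integrable hg).locallyIntegrable fun φ => ?_
  have hφ := congrArg (fun T => T φ) (Lp.fourier_toTemperedDistribution_eq (hg₂.toLp g))
  simp only [TemperedDistribution.fourier_apply, Lp.toTemperedDistribution_apply] at hφ
  rw [← hφ, ← integral_fourier_schwartz_smul hg φ]
  refine integral_congr_ae ?_
  filter_upwards [hg₂.coeFn_toLp] with x hx
  rw [hx]

theorem fourierInv_toLp_ae_eq (hg : Integrable g) (hg₂ : MemLp (𝓕 g) 2) :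
    (𝓕⁻ (hg₂.toLp (𝓕 g)) : Lp F 2 (volume : Measure E)) =ᵐ[volume] g := by
  refine ae_eq_of_integral_schwartz_smul_eq ((Lp.memLp _).locallyIntegrable one_le_two)
    hg.locallyIntegrable fun φ => ?_
  have hφ := congrArg (fun T => T φ) (Lp.fourierInv_toTemperedDistribution_eq (hg₂.toLp (𝓕 g)))
  simp only [TemperedDistribution.fourierInv_apply, Lp.toTemperedDistribution_apply] at hφ
  have hflip := integral_fourier_schwartz_smul hg (𝓕⁻ φ)
  rw [FourierTransform.fourier_fourierInv_eq] at hflip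
  rw [← hφ, hflip]
  refine integral_congr_ae ?_
  filter_upwards [hg₂.coeFn_toLp] with x hx
  rw [hx]

theorem memLp_two_fourier_iff (hg : Integrable g) : MemLp (𝓕 g) 2 ↔ MemLp g 2 :=
  ⟨fun h => (memLp_congr_ae (fourierInv_toLp_ae_eq hg h)).1 (Lp.memLp _),
    fun h => (memLp_congr_ae (fourier_toLp_ae_eq hg h)).1 (Lp.memLp _)⟩

theorem eLpNorm_two_fourier (hg : Integrable g) : eLpNorm (𝓕 g) 2 = eLpNorm g 2 := by
  by_cases hg₂ : MemLp g 2
  · rw [← eLpNorm_congr_ae (fourier_toLp_ae_eq hg hg₂), ← eLpNorm_congr_ae hg₂.coeFn_toLp,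
      ← Lp.enorm_def, ← Lp.enorm_def, ← ofReal_norm, ← ofReal_norm, Lp.norm_fourier_eq]
  · have hinf {u : E → F} (hu : AEStronglyMeasurable u) (hu₂ : ¬MemLp u 2) : eLpNorm u 2 = ⊤ := by
      simpa [MemLp, hu] using hu₂
    rw [hinf hg.1 hg₂, hinf (continuous_fourier_of_integrable hg).aestronglyMeasurable
      (mt (memLp_two_fourier_iff hg).1 hg₂)]

end Plancherel

theorem eLpNorm_two_sq {α E : Type*} [MeasurableSpace α] [NormedAddCommGroup E] (f : α → E)
    (μ : Measure α) : eLpNorm f 2 μ ^ 2 = ∫⁻ x, ‖f x‖ₑ ^ 2 ∂μ := by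
  rw [eLpNorm_eq_lintegral_rpow_enorm_toReal two_ne_zero ENNReal.ofNat_ne_top,
    ← ENNReal.rpow_natCast, ← ENNReal.rpow_mul]
  norm_num

theorem ofReal_abs_mul_lintegral_comp_mul_left (f : ℝ → ENNReal) {a : ℝ} (ha : a ≠ 0) :
    ENNReal.ofReal |a| * ∫⁻ x, f (a * x) = ∫⁻ x, f x := by
  have hmap : ∫⁻ x, f x ∂(Measure.map (a * ·) volume) = ∫⁻ x, f (a * x) :=
    lintegral_map_equiv f (Homeomorph.mulLeft₀ a ha).toMeasurableEquiv
  rw [← hmap, Real.map_volume_mul_left ha, lintegral_smul_measure, smul_eq_mul, ← mul_assoc,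
    ← ENNReal.ofReal_mul (abs_nonneg a), abs_inv, mul_inv_cancel₀ (abs_ne_zero.2 ha),
    ENNReal.ofReal_one, one_mul]

noncomputable section

theorem ae_halfLine_pos : ∀ᵐ x ∂halfLine, 0 < x := ae_restrict_mem measurableSet_Ioi

/-- The Fourier transform `∫₀^∞ e^{-iξx} g(x) dx` of a function on the half line, with the
normalization of the angular frequency `ξ` (no factor `2π` in the exponent). -/
def halfFourier (g : ℝ → ℝ) (ξ : ℝ) : ℂ :=
  ∫ x, Complex.exp (-(ξ * x : ℝ) * Complex.I) * g x ∂halfLine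

section HalfFourier

variable {g h : ℝ → ℝ}

theorem norm_exp_neg_mul_I (ξ : ℝ) : ‖Complex.exp (-(ξ : ℂ) * Complex.I)‖ = 1 := by
  rw [← Complex.ofReal_neg, Complex.norm_exp_ofReal_mul_I]

theorem integrable_halfFourier_kernel (hg : Integrable g halfLine) (ξ : ℝ) :
    Integrable (fun x => Complex.exp (-(ξ * x : ℝ) * Complex.I) * g x) halfLine :=
  hg.ofReal.bdd_mul (c := 1) (by fun_prop)
    (ae_of_all _ fun x => (norm_exp_neg_mul_I (ξ * x)).le)

theorem continuous_halfFourier (hg : Integrable g halfLine) : Continuous (halfFourier g) := by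
  refine continuous_of_dominated (bound := fun x => ‖g x‖)
    (fun ξ => (integrable_halfFourier_kernel hg ξ).1) (fun ξ => ae_of_all _ fun x => ?_) hg.norm
    (ae_of_all _ fun x => by fun_prop)
  rw [norm_mul, norm_exp_neg_mul_I, one_mul, Complex.norm_real]

theorem halfFourier_congr (hgh : g =ᵐ[halfLine] h) : halfFourier g = halfFourier h := by
  ext ξ
  refine integral_congr_ae ?_
  filter_upwards [hgh] with x hx
  rw [hx]

theorem norm_halfFourier_le (g : ℝ → ℝ) (ξ : ℝ) : ‖halfFourier g ξ‖ ≤ ∫ x, ‖g x‖ ∂halfLine := by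
  refine (norm_integral_le_integral_norm _).trans_eq ?_
  simp_rw [norm_mul, norm_exp_neg_mul_I, one_mul, Complex.norm_real]

theorem halfFourier_zero (g : ℝ → ℝ) : halfFourier g 0 = (∫ x, g x ∂halfLine : ℝ) := by
  simp [halfFourier, integral_complex_ofReal]

theorem halfFourier_add (hg : Integrable g halfLine) (hh : Integrable h halfLine) (ξ : ℝ) :
    halfFourier (fun x => g x + h x) ξ = halfFourier g ξ + halfFourier h ξ := by
  simp_rw [halfFourier, Complex.ofReal_add, mul_add]
  exact integral_add (integrable_halfFourier_kernel hg ξ) (integrable_halfFourier_kernel hh ξ)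

theorem halfFourier_sub (hg : Integrable g halfLine) (hh : Integrable h halfLine) (ξ : ℝ) :
    halfFourier (fun x => g x - h x) ξ = halfFourier g ξ - halfFourier h ξ := by
  simp_rw [halfFourier, Complex.ofReal_sub, mul_sub]
  exact integral_sub (integrable_halfFourier_kernel hg ξ) (integrable_halfFourier_kernel hh ξ)

theorem halfFourier_const_mul (c : ℝ) (g : ℝ → ℝ) (ξ : ℝ) :
    halfFourier (fun x => c * g x) ξ = c * halfFourier g ξ := by
  simp_rw [halfFourier, Complex.ofReal_mul, mul_left_comm _ (c : ℂ)]
  exact integral_const_mul _ _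

theorem halfFourier_two_pi_mul (g : ℝ → ℝ) (ξ : ℝ) :
    halfFourier g (2 * Real.pi * ξ) = 𝓕 (indicator (Ioi 0) fun x => (g x : ℂ)) ξ := by
  rw [Real.fourier_real_eq_integral_exp_smul, halfFourier, halfLine,
    ← integral_indicator measurableSet_Ioi]
  congr 1 with x
  by_cases hx : x ∈ Ioi (0 : ℝ)
  · simp only [indicator_of_mem hx, smul_eq_mul]
    congr 3
    push_cast
    ring
  · simp [indicator_of_notMem hx]

theorem lintegral_halfFourier_sq (hg : Integrable g halfLine) :
    ∫⁻ ξ, ‖halfFourier g ξ‖ₑ ^ 2 = ENNReal.ofReal (2 * Real.pi) * eLpNorm g 2 halfLine ^ 2 := by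
  have hind : Integrable (indicator (Ioi 0) fun x => (g x : ℂ)) :=
    (integrable_indicator_iff measurableSet_Ioi).2 hg.ofReal
  have hnorm : eLpNorm (fun x => (g x : ℂ)) 2 halfLine = eLpNorm g 2 halfLine :=
    eLpNorm_congr_norm_ae (ae_of_all _ fun x => Complex.norm_real _)
  rw [← ofReal_abs_mul_lintegral_comp_mul_left _ Real.two_pi_pos.ne',
    abs_of_pos Real.two_pi_pos, ← hnorm, halfLine,
    ← eLpNorm_indicator_eq_eLpNorm_restrict measurableSet_Ioi, ← eLpNorm_two_fourier hind,
    eLpNorm_two_sq]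
  simp_rw [halfFourier_two_pi_mul]

theorem ae_eq_of_halfFourier_eq (hg : Integrable g halfLine) (hh : Integrable h halfLine)
    (hgh : halfFourier g = halfFourier h) : g =ᵐ[halfLine] h := by
  have hzero (ξ : ℝ) : halfFourier (g - h) ξ = 0 := by
    simpa [hgh] using! halfFourier_sub hg hh ξ
  have hnorm : eLpNorm (g - h) 2 halfLine = 0 := by
    simpa [hzero, Real.pi_pos.not_ge] using (lintegral_halfFourier_sq (hg.sub hh)).symm
  rw [eLpNorm_eq_zero_iff (hg.sub hh).1 two_ne_zero] at hnorm
  filter_upwards [hnorm] with x hx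
  simpa [sub_eq_zero] using hx

end HalfFourier

section WeightedSpaces

variable {k : ℝ}

theorem halfLine_le_weightMeasure (hk : 0 ≤ k) : halfLine ≤ weightMeasure k := by
  refine withDensity_one.symm.le.trans (withDensity_mono ?_)
  filter_upwards [ae_halfLine_pos] with x hx
  simpa using Real.one_le_rpow (by linarith) hk

theorem ae_weightMeasure_iff (k : ℝ) {p : ℝ → Prop} :
    (∀ᵐ x ∂weightMeasure k, p x) ↔ ∀ᵐ x ∂halfLine, p x := by
  rw [weightMeasure, ae_withDensity_iff (by fun_prop)]
  refine eventually_congr ?_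
  filter_upwards [ae_halfLine_pos] with x hx
  simp [Real.rpow_pos_of_pos (by linarith : 0 < 1 + x) k]

theorem WeightedL1.integrable (hk : 0 ≤ k) (g : WeightedL1 k) : Integrable g halfLine :=
  (L1.integrable_coeFn g).mono_measure (halfLine_le_weightMeasure hk)

theorem WeightedL1.halfFourier_add (hk : 0 ≤ k) (g h : WeightedL1 k) (ξ : ℝ) :
    halfFourier (g + h : WeightedL1 k) ξ = halfFourier g ξ + halfFourier h ξ := by
  rw [← _root_.halfFourier_add (g.integrable hk) (h.integrable hk),
    halfFourier_congr ((ae_weightMeasure_iff k).1 (Lp.coeFn_add g h))]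
  rfl

theorem WeightedL1.halfFourier_smul (c : ℝ) (g : WeightedL1 k) (ξ : ℝ) :
    halfFourier (c • g : WeightedL1 k) ξ = c * halfFourier g ξ := by
  rw [← halfFourier_const_mul, halfFourier_congr ((ae_weightMeasure_iff k).1 (Lp.coeFn_smul c g))]
  rfl

theorem WeightedL1.norm_halfFourier_le (hk : 0 ≤ k) (g : WeightedL1 k) (ξ : ℝ) :
    ‖halfFourier g ξ‖ ≤ ‖g‖ := by
  refine (_root_.norm_halfFourier_le g ξ).trans ?_
  rw [L1.norm_eq_integral_norm]
  exact integral_mono_measure (halfLine_le_weightMeasure hk) (ae_of_all _ fun x => norm_nonneg _)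
    (L1.integrable_coeFn g).norm

/-- The Fourier transform at the frequency `ξ`, as a continuous linear form on `L¹_k`. -/
def halfFourierCLM (hk : 0 ≤ k) (ξ : ℝ) : WeightedL1 k →L[ℝ] ℂ :=
  LinearMap.mkContinuous
    { toFun := fun g => halfFourier g ξ
      map_add' := fun g h => WeightedL1.halfFourier_add hk g h ξ
      map_smul' := fun c g => WeightedL1.halfFourier_smul c g ξ }
    1 fun g => (WeightedL1.norm_halfFourier_le hk g ξ).trans_eq (one_mul _).symm

theorem halfFourierCLM_apply (hk : 0 ≤ k) (ξ : ℝ) (g : WeightedL1 k) :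
    halfFourierCLM hk ξ g = halfFourier g ξ := rfl

end WeightedSpaces

section Characteristics

variable {g h : ℝ → ℝ}

theorem dilation_congr (hgh : g =ᵐ[halfLine] h) (r : ℝ) :
    dilation r g =ᵐ[halfLine] dilation r h := by
  have hqmp : Measure.QuasiMeasurePreserving (Real.exp r * ·) volume volume :=
    ⟨by fun_prop, by
      rw [Real.map_volume_mul_left (Real.exp_ne_zero r)]
      exact Measure.smul_absolutelyContinuous⟩
  have hae := hqmp.ae ((ae_restrict_iff' measurableSet_Ioi).1 hgh)
  refine (ae_restrict_iff' measurableSet_Ioi).2 ?_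
  filter_upwards [hae] with x hx hx₀
  rw [dilation, dilation, hx (mul_pos (Real.exp_pos r) hx₀)]

theorem coagulation_congr (K : ℝ → ℝ → ℝ) (hgh : g =ᵐ[halfLine] h) :
    coagulation K g =ᵐ[halfLine] coagulation K h := by
  have hae : ∀ᵐ y, 0 < y → g y = h y := (ae_restrict_iff' measurableSet_Ioi).1 hgh
  filter_upwards [hgh, ae_halfLine_pos] with x hx hx₀
  have hgain : ∫ y in (0 : ℝ)..x, K (x - y) y * g (x - y) * g y =
      ∫ y in (0 : ℝ)..x, K (x - y) y * h (x - y) * h y := by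
    refine intervalIntegral.integral_congr_ae ?_
    filter_upwards [hae, (quasiMeasurePreserving_sub_left_of_right_invariant volume x).ae hae,
      Measure.ae_ne volume x] with y hy hxy hne hmem
    rw [uIoc_of_le hx₀.le] at hmem
    rw [hy hmem.1, hxy (sub_pos.2 (hmem.2.lt_of_ne hne))]
  have hloss : ∫ y in Ioi (0 : ℝ), K x y * g y = ∫ y in Ioi (0 : ℝ), K x y * h y := by
    refine integral_congr_ae ?_
    filter_upwards [hgh] with y hy
    rw [hy]
  rw [coagulation, coagulation, hgain, hloss, hx]

theorem integrable_dilation (hg : Integrable g halfLine) (r : ℝ) :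
    Integrable (dilation r g) halfLine :=
  ((integrableOn_Ioi_comp_mul_left_iff g 0 (Real.exp_pos r)).2 (by rwa [mul_zero])).const_mul _

theorem halfFourier_dilation (g : ℝ → ℝ) (r ξ : ℝ) :
    halfFourier (dilation r g) ξ = Real.exp r * halfFourier g (Real.exp (-r) * ξ) := by
  have hscale := integral_comp_mul_left_Ioi
    (fun x => Complex.exp (-(Real.exp (-r) * ξ * x : ℝ) * Complex.I) * g x) 0 (Real.exp_pos r)
  rw [mul_zero] at hscale
  have hexp : (Real.exp r : ℂ) = (Real.exp (2 * r) : ℝ) * ((Real.exp r)⁻¹ : ℝ) := by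
    rw [← Complex.ofReal_mul, ← Real.exp_neg, ← Real.exp_add]
    ring_nf
  rw [halfFourier, halfFourier, halfLine, hexp, mul_assoc,
    ← Complex.real_smul (x := (Real.exp r)⁻¹), ← hscale, ← integral_const_mul]
  congr 1 with x
  have hphase : Real.exp (-r) * ξ * (Real.exp r * x) = ξ * x := by
    rw [Real.exp_neg]
    field_simp
  rw [hphase, dilation]
  push_cast
  ring

theorem coagulation_two (g : ℝ → ℝ) :
    coagulation (fun _ _ => 2) g = fun x =>
      (∫ y in (0 : ℝ)..x, g y * g (x - y)) - 2 * (∫ y, g y ∂halfLine) * g x := by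
  ext x
  rw [coagulation, halfLine, integral_const_mul, ← intervalIntegral.integral_const_mul]
  congr 1
  · congr 1 with y
    ring
  · ring

theorem integrable_selfConvolution (hg : Integrable g halfLine) :
    Integrable (fun x => ∫ y in (0 : ℝ)..x, g y * g (x - y)) halfLine := by
  have hconv := integrable_posConvolution (μ := volume) (ν := volume) hg hg
    (ContinuousLinearMap.mul ℝ ℝ)
  rwa [posConvolution, integrable_indicator_iff measurableSet_Ioi] at hconv

theorem halfFourier_selfConvolution (hg : Integrable g halfLine) (ξ : ℝ) :
    halfFourier (fun x => ∫ y in (0 : ℝ)..x, g y * g (x - y)) ξ = halfFourier g ξ ^ 2 := by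
  have hker := integrable_halfFourier_kernel hg ξ
  rw [sq]
  refine Eq.trans ?_ (integral_posConvolution (μ := volume) (ν := volume) hker hker
    (ContinuousLinearMap.mul ℝ ℂ))
  rw [halfFourier, halfLine]
  congr 1 with x
  rw [← intervalIntegral.integral_ofReal, ← intervalIntegral.integral_const_mul]
  congr 1 with y
  have hphase : Complex.exp (-(ξ * x : ℝ) * Complex.I) =
      Complex.exp (-(ξ * y : ℝ) * Complex.I) * Complex.exp (-(ξ * (x - y) : ℝ) * Complex.I) := by
    rw [← Complex.exp_add]
    push_cast
    ring_nf
  rw [ContinuousLinearMap.mul_apply', hphase]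
  push_cast
  ring

theorem halfFourier_coagulation_two (hg : Integrable g halfLine) (ξ : ℝ) :
    halfFourier (coagulation (fun _ _ => 2) g) ξ =
      halfFourier g ξ ^ 2 - 2 * halfFourier g 0 * halfFourier g ξ := by
  rw [coagulation_two, halfFourier_sub (integrable_selfConvolution hg) (hg.const_mul _),
    halfFourier_selfConvolution hg, halfFourier_const_mul, halfFourier_zero]
  push_cast
  ring

/-- The Fourier transform at the point `e^t w` of the characteristic issued from `w`, normalized
so as to be invariant under the dilation semigroup: `t ↦ charFourier t (S_t g) w` is constant. -/
def charFourier (t : ℝ) (g : ℝ → ℝ) (w : ℝ) : ℂ :=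
  Real.exp (-t) * halfFourier g (Real.exp t * w)

theorem charFourier_dilation (t r : ℝ) (g : ℝ → ℝ) (w : ℝ) :
    charFourier t (dilation r g) w = charFourier (t - r) g w := by
  rw [charFourier, charFourier, halfFourier_dilation, ← mul_assoc, ← mul_assoc,
    ← Complex.ofReal_mul, ← Real.exp_add, ← Real.exp_add]
  ring_nf

theorem charFourier_coagulation_two (t : ℝ) (hg : Integrable g halfLine) (w : ℝ) :
    charFourier t (coagulation (fun _ _ => 2) g) w =
      Real.exp t * (charFourier t g w ^ 2 - 2 * charFourier t g 0 * charFourier t g w) := by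
  have hexp : (Real.exp t : ℂ) * Real.exp (-t) = 1 := by
    rw [← Complex.ofReal_mul, ← Real.exp_add]
    simp
  rw [charFourier, charFourier, charFourier, halfFourier_coagulation_two hg, mul_zero]
  linear_combination -(Real.exp (-t) : ℂ) * (halfFourier g (Real.exp t * w) ^ 2 -
    2 * halfFourier g 0 * halfFourier g (Real.exp t * w)) * hexp

end Characteristics

section Riccati

theorem hasDerivWithinAt_integral_Ici {E : Type*} [NormedAddCommGroup E] [NormedSpace ℝ E]
    [CompleteSpace E] {u : ℝ → E} {a T : ℝ} (hu : ContinuousOn u (Icc a T)) {s : ℝ}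
    (hs : s ∈ Ico a T) : HasDerivWithinAt (fun t => ∫ r in a..t, u r) (u s) (Ici s) s := by
  have hnhds : Icc a T ∈ 𝓝[>] s := Filter.mem_of_superset (Ioc_mem_nhdsGT hs.2)
    fun r hr => ⟨hs.1.trans hr.1.le, hr.2⟩
  refine intervalIntegral.integral_hasDerivWithinAt_right
    ((hu.mono (Icc_subset_Icc_right hs.2.le)).intervalIntegrable_of_Icc hs.1)
    (t := Ioi s) ?_ ?_
  · exact ⟨Icc a T, hnhds, hu.aestronglyMeasurable measurableSet_Icc⟩
  · exact (hu s (Ico_subset_Icc_self hs)).mono_of_mem_nhdsWithin hnhds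

variable {A : Type*} [NormedCommRing A] [NormedAlgebra ℝ A]

theorem mul_one_add_mul_eq_of_hasDerivWithinAt_riccati {y b β : ℝ → A} {a T : ℝ}
    (hy : ContinuousOn y (Icc a T)) (hb : ContinuousOn b (Icc a T))
    (hβ : ContinuousOn β (Icc a T)) (hβa : β a = 0)
    (hy' : ∀ s ∈ Ico a T, HasDerivWithinAt y (-(b s * y s ^ 2)) (Ici s) s)
    (hβ' : ∀ s ∈ Ico a T, HasDerivWithinAt β (b s) (Ici s) s) {t : ℝ} (ht : t ∈ Icc a T) :
    y t * (1 + β t * y a) = y a := by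
  obtain ⟨M, hM⟩ := isCompact_Icc.exists_bound_of_continuousOn (hb.mul hy)
  -- Clearing the denominator of `y = y a / (1 + β * y a)` gives a defect which vanishes at `a` and
  -- solves a linear equation, whether or not `1 + β * y a` is invertible.
  have hdefect : ∀ s ∈ Ico a T, HasDerivWithinAt (fun s => y s * (1 + β s * y a) - y a)
      (-(b s * y s) * (y s * (1 + β s * y a) - y a)) (Ici s) s := fun s hs =>
    (((hy' s hs).mul (((hβ' s hs).mul_const (y a)).const_add 1)).sub_const (y a)).congr_deriv
      (by ring)
  refine sub_eq_zero.1 (eq_zero_of_abs_deriv_le_mul_abs_self_of_eq_zero_right (K := M)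
    (f := fun s => y s * (1 + β s * y a) - y a) (by fun_prop) hdefect (by simp [hβa])
    (fun s hs => (norm_mul_le _ _).trans ?_) t ht)
  rw [norm_neg]
  exact mul_le_mul_of_nonneg_right (hM s (Ico_subset_Icc_self hs)) (norm_nonneg _)

theorem mul_one_add_integral_mul_eq_of_integral_riccati [CompleteSpace A] {y b : ℝ → A}
    {y₀ : A} {T : ℝ} (hT : 0 ≤ T) (hb : ContinuousOn b (Icc 0 T))
    (hi : IntervalIntegrable (fun s => b s * y s ^ 2) volume 0 T)
    (hy : ∀ t ∈ Icc 0 T, y t = y₀ - ∫ s in (0 : ℝ)..t, b s * y s ^ 2) :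
    y T * (1 + (∫ s in (0 : ℝ)..T, b s) * y₀) = y₀ := by
  have hprim {u : ℝ → A} (hu : IntervalIntegrable u volume 0 T) :
      ContinuousOn (fun t => ∫ s in (0 : ℝ)..t, u s) (Icc 0 T) := by
    have := intervalIntegral.continuousOn_primitive_interval
      ((intervalIntegrable_iff' enorm_ne_top).1 hu)
    rwa [uIcc_of_le hT] at this
  have hycont : ContinuousOn y (Icc 0 T) := (continuousOn_const.sub (hprim hi)).congr hy
  have hy₀ : y 0 = y₀ := by simpa using hy 0 ⟨le_rfl, hT⟩
  rw [← hy₀]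
  refine mul_one_add_mul_eq_of_hasDerivWithinAt_riccati hycont hb
    (hprim (hb.intervalIntegrable_of_Icc hT)) intervalIntegral.integral_same (fun s hs => ?_)
    (fun s hs => hasDerivWithinAt_integral_Ici hb hs) ⟨hT, le_rfl⟩
  have heq : y =ᶠ[𝓝[≥] s] fun t => y₀ - ∫ r in (0 : ℝ)..t, b r * y r ^ 2 :=
    Filter.mem_of_superset (Ico_mem_nhdsGE hs.2) fun r hr => hy r ⟨hs.1.trans hr.1, hr.2.le⟩
  exact ((hasDerivWithinAt_integral_Ici (by fun_prop) hs).const_sub y₀).congr_of_eventuallyEq_of_mem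
    heq self_mem_Ici

end Riccati

section ExplicitSolution

/-- The flow of the logistic equation `y' = y - y²`, at the time `log a`. -/
def logisticFlow (a z : ℂ) : ℂ := a * z / (1 + (a - 1) * z)

theorem mul_eq_logisticFlow {a y z : ℂ} (h : y * (1 + (a - 1) * z) = z) :
    a * y = logisticFlow a z := by
  have hden : 1 + (a - 1) * z ≠ 0 := fun h₀ => by
    have hz : z = 0 := by rw [← h, h₀, mul_zero]
    simp [hz] at h₀
  rw [logisticFlow, eq_div_iff hden, mul_assoc, h]

variable {k : ℝ} {f₀ : WeightedL1 k} {f : ℝ → WeightedL1 k}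

theorem IsMildSolution.charFourier_duhamel (hk : 0 ≤ k)
    (h : IsMildSolution (fun _ _ => 2) f₀ f) {t : ℝ} (ht : 0 ≤ t) (w : ℝ) :
    IntervalIntegrable (fun s => (Real.exp s : ℂ) *
      (charFourier s (f s) w ^ 2 - 2 * charFourier s (f s) 0 * charFourier s (f s) w)) volume 0 t ∧
    charFourier t (f t) w = halfFourier f₀ w + ∫ s in (0 : ℝ)..t, (Real.exp s : ℂ) *
      (charFourier s (f s) w ^ 2 - 2 * charFourier s (f s) 0 * charFourier s (f s) w) := by
  obtain ⟨Φ, hΦ, hi, hf⟩ := h.duhamel t ht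
  set L : WeightedL1 k →L[ℝ] ℂ := Real.exp (-t) • halfFourierCLM hk (Real.exp t * w)
  have hL (g : WeightedL1 k) : L g = charFourier t g w := Complex.real_smul
  have hLΦ : ∀ s ∈ Icc 0 t, L (Φ s) = Real.exp s *
      (charFourier s (f s) w ^ 2 - 2 * charFourier s (f s) 0 * charFourier s (f s) w) :=
    fun s hs => by
      rw [hL, ← charFourier_coagulation_two s ((f s).integrable hk), charFourier,
        halfFourier_congr (hΦ s hs), ← charFourier, charFourier_dilation, sub_sub_cancel]
  have hLi : IntervalIntegrable (fun s => L (Φ s)) volume 0 t :=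
    ⟨L.integrable_comp hi.1, L.integrable_comp hi.2⟩
  refine ⟨hLi.congr fun s hs => hLΦ s ?_, ?_⟩
  · rw [uIoc_of_le ht] at hs
    exact Ioc_subset_Icc_self hs
  · rw [← intervalIntegral.integral_congr fun s hs => hLΦ s (by rwa [uIcc_of_le ht] at hs),
      L.intervalIntegral_comp_comm hi, hL, charFourier, halfFourier_congr hf,
      halfFourier_add (integrable_dilation (f₀.integrable hk) t) (WeightedL1.integrable hk _),
      mul_add, ← charFourier, charFourier_dilation]
    simp [charFourier]

theorem integral_exp_complex (t : ℝ) :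
    ∫ s in (0 : ℝ)..t, (Real.exp s : ℂ) = Real.exp t - 1 := by
  rw [intervalIntegral.integral_ofReal, integral_exp, Real.exp_zero]
  push_cast
  rfl

theorem IsMildSolution.charFourier_zero_riccati (hk : 0 ≤ k)
    (h : IsMildSolution (fun _ _ => 2) f₀ f) {t : ℝ} (ht : 0 ≤ t) :
    charFourier t (f t) 0 * (1 + (Real.exp t - 1) * halfFourier f₀ 0) = halfFourier f₀ 0 := by
  have hsource (s : ℝ) : (Real.exp s : ℂ) * charFourier s (f s) 0 ^ 2 = -(Real.exp s *
      (charFourier s (f s) 0 ^ 2 - 2 * charFourier s (f s) 0 * charFourier s (f s) 0)) := by ring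
  rw [← integral_exp_complex]
  refine mul_one_add_integral_mul_eq_of_integral_riccati (y := fun s => charFourier s (f s) 0) ht
    (by fun_prop) ?_ fun s hs => ?_
  · simp_rw [hsource]
    exact (h.charFourier_duhamel hk ht 0).1.neg
  · simp_rw [hsource]
    rw [intervalIntegral.integral_neg, sub_neg_eq_add]
    exact (h.charFourier_duhamel hk hs.1 0).2

theorem IsMildSolution.charFourier_sub_riccati (hk : 0 ≤ k)
    (h : IsMildSolution (fun _ _ => 2) f₀ f) {t : ℝ} (ht : 0 ≤ t) (w : ℝ) :
    (charFourier t (f t) 0 - charFourier t (f t) w) *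
      (1 + (Real.exp t - 1) * (halfFourier f₀ 0 - halfFourier f₀ w)) =
    halfFourier f₀ 0 - halfFourier f₀ w := by
  have hsource (s : ℝ) : (Real.exp s : ℂ) * (charFourier s (f s) 0 - charFourier s (f s) w) ^ 2 =
      Real.exp s * (charFourier s (f s) w ^ 2 - 2 * charFourier s (f s) 0 * charFourier s (f s) w)
      - Real.exp s *
        (charFourier s (f s) 0 ^ 2 - 2 * charFourier s (f s) 0 * charFourier s (f s) 0) := by ring
  rw [← integral_exp_complex]
  refine mul_one_add_integral_mul_eq_of_integral_riccati
    (y := fun s => charFourier s (f s) 0 - charFourier s (f s) w) ht (by fun_prop) ?_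
    fun s hs => ?_
  · simp_rw [hsource]
    exact (h.charFourier_duhamel hk ht w).1.sub (h.charFourier_duhamel hk ht 0).1
  · obtain ⟨hi₀, h₀⟩ := h.charFourier_duhamel hk hs.1 0
    obtain ⟨hiw, hw⟩ := h.charFourier_duhamel hk hs.1 w
    simp_rw [hsource]
    rw [intervalIntegral.integral_sub hiw hi₀, h₀, hw]
    ring

theorem IsMildSolution.halfFourier_eq (hk : 0 ≤ k) (h : IsMildSolution (fun _ _ => 2) f₀ f)
    {t : ℝ} (ht : 0 ≤ t) (w : ℝ) :
    halfFourier (f t) (Real.exp t * w) = logisticFlow (Real.exp t) (halfFourier f₀ 0) -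
      logisticFlow (Real.exp t) (halfFourier f₀ 0 - halfFourier f₀ w) := by
  have hexp : (Real.exp t : ℂ) * Real.exp (-t) = 1 := by
    rw [← Complex.ofReal_mul, ← Real.exp_add]
    simp
  rw [← mul_eq_logisticFlow (h.charFourier_zero_riccati hk ht),
    ← mul_eq_logisticFlow (h.charFourier_sub_riccati hk ht w), charFourier, charFourier]
  linear_combination -halfFourier (f t) (Real.exp t * w) * hexp

end ExplicitSolution

section StationaryProfile

theorem continuousOn_L1_of_dominated {α E X : Type*} [MeasurableSpace α] [NormedAddCommGroup E]
    [TopologicalSpace X] [FirstCountableTopology X] {μ : Measure α} {c : X → Lp E 1 μ}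
    {F : X → α → E} {bound : α → ℝ} {s : Set X} (hc : ∀ r ∈ s, c r =ᵐ[μ] F r)
    (hbound : Integrable bound μ) (hF : ∀ r ∈ s, ∀ᵐ x ∂μ, ‖F r x‖ ≤ bound x)
    (hcont : ∀ᵐ x ∂μ, ContinuousOn (fun r => F r x) s) : ContinuousOn c s := by
  have hmeas : ∀ r ∈ s, AEStronglyMeasurable (F r) μ := fun r hr =>
    (Lp.aestronglyMeasurable (c r)).congr (hc r hr)
  intro r₀ hr₀
  have hdist : ContinuousOn (fun r => ∫ x, ‖F r x - F r₀ x‖ ∂μ) s := by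
    refine continuousOn_of_dominated (bound := fun x => bound x + bound x)
      (fun r hr => ((hmeas r hr).sub (hmeas r₀ hr₀)).norm) (fun r hr => ?_)
      (hbound.add hbound) ?_
    · filter_upwards [hF r hr, hF r₀ hr₀] with x hx hx₀
      rw [norm_norm]
      exact (norm_sub_le _ _).trans (add_le_add hx hx₀)
    · filter_upwards [hcont] with x hx
      exact (hx.sub continuousOn_const).norm
  rw [ContinuousWithinAt, tendsto_iff_norm_sub_tendsto_zero]
  have hlim : Tendsto (fun r => ∫ x, ‖F r x - F r₀ x‖ ∂μ) (𝓝[s] r₀) (𝓝 0) := by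
    simpa [ContinuousWithinAt] using hdist r₀ hr₀
  refine hlim.congr' ?_
  filter_upwards [self_mem_nhdsWithin] with r hr
  rw [L1.norm_eq_integral_norm]
  refine integral_congr_ae ?_
  filter_upwards [Lp.coeFn_sub (c r) (c r₀), hc r hr, hc r₀ hr₀] with x hsub hx hx₀
  rw [hsub, Pi.sub_apply, hx, hx₀]

theorem integrable_weightMeasure_one_iff {g : ℝ → ℝ} :
    Integrable g (weightMeasure 1) ↔
      Integrable g halfLine ∧ Integrable (fun x => x * g x) halfLine := by
  have hweight : Integrable g (weightMeasure 1) ↔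
      Integrable (fun x => g x + x * g x) halfLine := by
    rw [weightMeasure, integrable_withDensity_iff_integrable_smul' (by fun_prop)
      (ae_of_all _ fun x => ENNReal.ofReal_lt_top)]
    refine integrable_congr ?_
    filter_upwards [ae_halfLine_pos] with x hx
    rw [Real.rpow_one, ENNReal.toReal_ofReal (by linarith), smul_eq_mul]
    ring
  refine ⟨fun h => ?_, fun h => hweight.2 (h.1.add h.2)⟩
  have hg := h.mono_measure (halfLine_le_weightMeasure zero_le_one)
  exact ⟨hg, ((hweight.1 h).sub hg).congr (ae_of_all _ fun x => add_sub_cancel_left _ _)⟩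

theorem integrable_dilation_weightMeasure_one {g : ℝ → ℝ} (hg : Integrable g (weightMeasure 1))
    (r : ℝ) : Integrable (dilation r g) (weightMeasure 1) := by
  rw [integrable_weightMeasure_one_iff] at hg ⊢
  refine ⟨integrable_dilation hg.1 r, ((integrable_dilation hg.2 r).const_mul
    (Real.exp (-r))).congr (ae_of_all _ fun x => ?_)⟩
  simp only [dilation, Real.exp_neg]
  field_simp

theorem integrable_pow_mul_exp_neg (n : ℕ) :
    Integrable (fun x : ℝ => x ^ n * Real.exp (-x)) halfLine := by
  refine (Real.GammaIntegral_convergent (s := n + 1) (by positivity)).congr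
    (ae_of_all _ fun x => ?_)
  simp [mul_comm]

theorem integrable_affine_mul_exp_neg (a b : ℝ) :
    Integrable (fun x : ℝ => (a * x + b) * Real.exp (-x)) (weightMeasure 1) := by
  rw [integrable_weightMeasure_one_iff]
  constructor
  · refine (((integrable_pow_mul_exp_neg 1).const_mul a).add
      ((integrable_pow_mul_exp_neg 0).const_mul b)).congr (ae_of_all _ fun x => ?_)
    simp only [Pi.add_apply]
    ring
  · refine (((integrable_pow_mul_exp_neg 2).const_mul a).add
      ((integrable_pow_mul_exp_neg 1).const_mul b)).congr (ae_of_all _ fun x => ?_)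
    simp only [Pi.add_apply]
    ring

/-- The profile `e^{-x}` as an element of `L¹_1`. -/
def expProfile : WeightedL1 1 := (integrable_affine_mul_exp_neg 0 1).toL1 _

theorem expProfile_ae_eq : expProfile =ᵐ[halfLine] fun x => Real.exp (-x) := by
  filter_upwards [(ae_weightMeasure_iff 1).1 (integrable_affine_mul_exp_neg 0 1).coeFn_toL1]
    with x hx
  rw [expProfile, hx]
  ring

theorem isUnitMassDensity_expProfile : IsUnitMassDensity expProfile := by
  have hmass : (fun x => x * expProfile x) =ᵐ[halfLine] fun x => x ^ 1 * Real.exp (-x) := by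
    filter_upwards [expProfile_ae_eq] with x hx
    rw [hx, pow_one]
  refine ⟨?_, (integrable_pow_mul_exp_neg 1).congr hmass.symm, ?_⟩
  · filter_upwards [expProfile_ae_eq] with x hx
    rw [hx]
    positivity
  · rw [integral_congr_ae hmass, ← Real.Gamma_two, Real.Gamma_eq_integral two_pos, halfLine]
    refine setIntegral_congr_fun measurableSet_Ioi fun x _ => ?_
    norm_num [mul_comm]

theorem halfFourier_expProfile (ξ : ℝ) :
    halfFourier expProfile ξ = (1 + ξ * Complex.I)⁻¹ := by
  rw [halfFourier_congr expProfile_ae_eq]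
  calc halfFourier (fun x => Real.exp (-x)) ξ
      = ∫ x : ℝ in Ioi 0, Complex.exp (-(1 + ξ * Complex.I) * x) := by
        rw [halfFourier, halfLine]
        congr 1 with x
        rw [Complex.ofReal_exp, ← Complex.exp_add]
        push_cast
        ring_nf
    _ = (1 + ξ * Complex.I)⁻¹ := by
        rw [integral_exp_mul_complex_Ioi (by simp) 0, Complex.ofReal_zero, mul_zero,
          Complex.exp_zero, neg_div_neg_eq, one_div]

theorem coagulation_exp_neg (x : ℝ) :
    coagulation (fun _ _ => 2) (fun y => Real.exp (-y)) x = (x - 2) * Real.exp (-x) := by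
  have hprod (y : ℝ) : Real.exp (-y) * Real.exp (-(x - y)) = Real.exp (-x) := by
    rw [← Real.exp_add]
    ring_nf
  have hint : ∫ y, Real.exp (-y) ∂halfLine = 1 := integral_exp_neg_Ioi_zero
  simp only [coagulation_two, hprod, hint, intervalIntegral.integral_const, smul_eq_mul]
  ring

theorem coagulation_expProfile :
    coagulation (fun _ _ => 2) expProfile =ᵐ[halfLine] fun x => (1 * x + -2) * Real.exp (-x) := by
  refine (coagulation_congr _ expProfile_ae_eq).trans (ae_of_all _ fun x => ?_)
  rw [coagulation_exp_neg]
  ring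

/-- The curve `r ↦ S_r C(G, G)` in `L¹_1`, for the profile `G = e^{-x}`, for which
`C(G, G) = (x - 2) e^{-x}`. -/
def profileSource (r : ℝ) : WeightedL1 1 :=
  (integrable_dilation_weightMeasure_one (integrable_affine_mul_exp_neg 1 (-2)) r).toL1 _

theorem profileSource_ae_eq (r : ℝ) :
    profileSource r =ᵐ[weightMeasure 1] dilation r fun x => (1 * x + -2) * Real.exp (-x) :=
  Integrable.coeFn_toL1 _

theorem profileSource_ae_eq_dilation_coagulation (r : ℝ) :
    profileSource r =ᵐ[halfLine] dilation r (coagulation (fun _ _ => 2) expProfile) :=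
  EventuallyEq.trans ((ae_weightMeasure_iff 1).1 (profileSource_ae_eq r))
    (dilation_congr coagulation_expProfile r).symm

theorem continuousOn_profileSource (T : ℝ) : ContinuousOn profileSource (Icc 0 T) := by
  refine continuousOn_L1_of_dominated (fun r _ => profileSource_ae_eq r)
    ((integrable_affine_mul_exp_neg (Real.exp T) 2).const_mul (Real.exp (2 * T)))
    (fun r hr => ?_) (ae_of_all _ fun x => ?_)
  · rw [ae_weightMeasure_iff]
    filter_upwards [ae_halfLine_pos] with x hx
    have hlower : x ≤ Real.exp r * x := le_mul_of_one_le_left hx.le (Real.one_le_exp hr.1)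
    have hupper : Real.exp r * x ≤ Real.exp T * x := by
      gcongr
      exact hr.2
    rw [dilation, Real.norm_eq_abs, abs_mul, abs_mul, Real.abs_exp, Real.abs_exp]
    gcongr
    · exact hr.2
    · rw [abs_le]
      constructor <;> linarith
  · unfold dilation
    fun_prop

theorem halfFourier_profileSource (r ξ : ℝ) :
    halfFourier (profileSource r) ξ = Real.exp r *
      ((1 + (Real.exp (-r) * ξ : ℝ) * Complex.I)⁻¹ ^ 2 -
        2 * (1 + (Real.exp (-r) * ξ : ℝ) * Complex.I)⁻¹) := by
  rw [halfFourier_congr (profileSource_ae_eq_dilation_coagulation r), halfFourier_dilation,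
    halfFourier_coagulation_two (expProfile.integrable zero_le_one), halfFourier_expProfile,
    halfFourier_expProfile]
  simp

theorem one_add_mul_I_ne_zero (ξ : ℝ) : (1 + ξ * Complex.I : ℂ) ≠ 0 := fun h => by
  simpa using congrArg Complex.re h

theorem hasDerivAt_halfFourier_dilation_expProfile (r ξ : ℝ) :
    HasDerivAt (fun r : ℝ => halfFourier (dilation r expProfile) ξ)
      (-halfFourier (profileSource r) ξ) r := by
  simp_rw [halfFourier_dilation, halfFourier_expProfile]
  have hden := (((((hasDerivAt_neg r).exp.mul_const ξ).ofReal_comp).mul_const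
    Complex.I).const_add 1).fun_inv (one_add_mul_I_ne_zero (Real.exp (-r) * ξ))
  refine ((Real.hasDerivAt_exp r).ofReal_comp.mul hden).congr_deriv ?_
  rw [halfFourier_profileSource]
  have hne := one_add_mul_I_ne_zero (Real.exp (-r) * ξ)
  push_cast at hne ⊢
  field_simp
  ring

theorem dilation_zero (g : ℝ → ℝ) : dilation 0 g = g := by
  ext x
  simp [dilation]

theorem halfFourier_integral_profileSource (t ξ : ℝ) (ht : 0 ≤ t) :
    halfFourier (∫ r in (0 : ℝ)..t, profileSource r : WeightedL1 1) ξ =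
      halfFourier expProfile ξ - halfFourier (dilation t expProfile) ξ := by
  have hint : IntervalIntegrable profileSource volume 0 t :=
    (continuousOn_profileSource t).intervalIntegrable_of_Icc ht
  have hftc := intervalIntegral.integral_eq_sub_of_hasDerivAt
    (fun r _ => hasDerivAt_halfFourier_dilation_expProfile r ξ)
    (IntervalIntegrable.neg (f := fun r => halfFourier (profileSource r) ξ)
      ⟨(halfFourierCLM zero_le_one ξ).integrable_comp hint.1,
        (halfFourierCLM zero_le_one ξ).integrable_comp hint.2⟩)
  rw [← halfFourierCLM_apply zero_le_one, ← ContinuousLinearMap.intervalIntegral_comp_comm _ hint]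
  simp only [halfFourierCLM_apply]
  rw [intervalIntegral.integral_neg, dilation_zero] at hftc
  linear_combination -hftc

theorem isProfile_expProfile : IsProfile (fun _ _ => 2) expProfile := by
  refine ⟨continuousOn_const, fun t ht => ⟨fun s => profileSource (t - s),
    fun s _ => profileSource_ae_eq_dilation_coagulation (t - s), ?_, ?_⟩⟩
  · refine ContinuousOn.intervalIntegrable_of_Icc ht ((continuousOn_profileSource t).comp
      (by fun_prop) fun s hs => ⟨sub_nonneg.2 hs.2, sub_le_self _ hs.1⟩)
  · have hG := expProfile.integrable zero_le_one
    have hi := (∫ r in (0 : ℝ)..t, profileSource r : WeightedL1 1).integrable zero_le_one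
    rw [intervalIntegral.integral_comp_sub_left, sub_self, sub_zero]
    refine ae_eq_of_halfFourier_eq hG ((integrable_dilation hG t).add hi) (funext fun ξ => ?_)
    rw [halfFourier_add (integrable_dilation hG t) hi, halfFourier_integral_profileSource t ξ ht]
    ring

end StationaryProfile

section Uniqueness

theorem hasDerivAt_halfFourier {g : ℝ → ℝ} (hg : Integrable g halfLine)
    (hxg : Integrable (fun x => x * g x) halfLine) (ξ : ℝ) :
    HasDerivAt (halfFourier g) (-Complex.I * halfFourier (fun x => x * g x) ξ) ξ := by
  have hkernel (x s : ℝ) : HasDerivAt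
      (fun s : ℝ => Complex.exp (-(s * x : ℝ) * Complex.I) * g x)
      (-Complex.I * (Complex.exp (-(s * x : ℝ) * Complex.I) * (x * g x : ℝ))) s := by
    refine (((hasDerivAt_mul_const x).ofReal_comp.fun_neg.mul_const Complex.I).cexp.mul_const
      (g x : ℂ)).congr_deriv ?_
    push_cast
    ring
  have hderiv := (hasDerivAt_integral_of_dominated_loc_of_deriv_le (μ := halfLine)
    (bound := fun x => ‖x * g x‖) univ_mem
    (Eventually.of_forall fun s => (integrable_halfFourier_kernel hg s).1)
    (integrable_halfFourier_kernel hg ξ)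
    ((integrable_halfFourier_kernel hxg ξ).1.const_mul (-Complex.I))
    (ae_of_all _ fun x s _ => by
      rw [norm_mul, norm_mul, norm_exp_neg_mul_I, norm_neg, Complex.norm_I, one_mul, one_mul,
        Complex.norm_real])
    hxg.norm (ae_of_all _ fun x s _ => hkernel x s)).2
  rwa [integral_const_mul] at hderiv

theorem one_sub_div_one_add {z : ℂ} (hz : 1 + z ≠ 0) : 1 - z / (1 + z) = (1 + z)⁻¹ := by
  rw [one_sub_div hz, add_sub_cancel_right, one_div]

theorem IsUnitMassDensity.integral_pos {g : ℝ → ℝ} (h : IsUnitMassDensity g)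
    (hg : Integrable g halfLine) : 0 < ∫ x, g x ∂halfLine := by
  refine (integral_nonneg_of_ae h.1).lt_of_ne fun hzero => ?_
  have hmass : ∫ x, x * g x ∂halfLine = 0 := by
    refine integral_eq_zero_of_ae ?_
    filter_upwards [(integral_eq_zero_iff_of_nonneg_ae h.1 hg).1 hzero.symm] with x hx
    simp [hx]
  exact one_ne_zero (h.2.2.symm.trans hmass)

theorem IsUnitMassDensity.tendsto_mul_halfFourier_sub {g : ℝ → ℝ} (h : IsUnitMassDensity g)
    (hg : Integrable g halfLine) (ξ : ℝ) :
    Tendsto (fun s : ℝ => (s : ℂ) * (halfFourier g 0 - halfFourier g (s⁻¹ * ξ))) atTop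
      (𝓝 (ξ * Complex.I)) := by
  have hderiv : HasDerivAt (fun s : ℝ => halfFourier g (s * ξ)) (-(ξ * Complex.I)) 0 := by
    have hcomp := (hasDerivAt_halfFourier hg h.2.1 (0 * ξ)).scomp 0 (hasDerivAt_mul_const ξ)
    rw [zero_mul, halfFourier_zero, h.2.2] at hcomp
    exact hcomp.congr_deriv (by rw [Complex.real_smul]; push_cast; ring)
  have hslope := (hderiv.tendsto_slope_zero_right.comp tendsto_inv_atTop_nhdsGT_zero).neg
  rw [neg_neg] at hslope
  refine hslope.congr fun s => ?_
  simp only [Function.comp_apply, inv_inv, zero_add, zero_mul, Complex.real_smul]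
  ring

theorem tendsto_logisticFlow_of_tendsto_mul {ι : Type*} {l : Filter ι} {a z : ι → ℂ} {c : ℂ}
    (haz : Tendsto (fun i => a i * z i) l (𝓝 c)) (hz : Tendsto z l (𝓝 0)) (hc : 1 + c ≠ 0) :
    Tendsto (fun i => logisticFlow (a i) (z i)) l (𝓝 (c / (1 + c))) := by
  have hden : Tendsto (fun i => 1 + (a i - 1) * z i) l (𝓝 (1 + c)) := by
    simpa [sub_mul] using! (haz.sub hz).const_add 1
  exact haz.div hden hc

theorem tendsto_logisticFlow_atTop {z : ℂ} (hz : z ≠ 0) :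
    Tendsto (fun a : ℝ => logisticFlow a z) atTop (𝓝 1) := by
  have hinv : Tendsto (fun a : ℝ => (a : ℂ)⁻¹) atTop (𝓝 0) := by
    exact_mod_cast (tendsto_inv_atTop_zero (𝕜 := ℝ)).ofReal
  have hlim : Tendsto (fun a : ℝ => z / ((a : ℂ)⁻¹ + (1 - (a : ℂ)⁻¹) * z)) atTop (𝓝 1) := by
    have h := (tendsto_const_nhds (x := z)).div
      (hinv.add ((hinv.const_sub 1).mul_const z)) (by simpa using hz)
    simpa [hz] using! h
  refine hlim.congr' ?_
  filter_upwards [eventually_ne_atTop 0] with a ha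
  have ha' : (a : ℂ) ≠ 0 := by exact_mod_cast ha
  rw [logisticFlow, ← mul_div_mul_left z _ ha']
  congr 1
  field_simp

variable {k : ℝ} {f₀ : WeightedL1 k} {f : ℝ → WeightedL1 k}

theorem IsMildSolution.tendsto_halfFourier (hk : 0 ≤ k)
    (h : IsMildSolution (fun _ _ => 2) f₀ f) (hmass : IsUnitMassDensity f₀) (ξ : ℝ) :
    Tendsto (fun t => halfFourier (f t) ξ) atTop (𝓝 (1 + ξ * Complex.I)⁻¹) := by
  have hf₀ := f₀.integrable hk
  have hnumber : halfFourier f₀ 0 ≠ 0 := by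
    rw [halfFourier_zero, Complex.ofReal_ne_zero]
    exact (hmass.integral_pos hf₀).ne'
  have hdefect : Tendsto (fun s : ℝ => halfFourier f₀ 0 - halfFourier f₀ (s⁻¹ * ξ)) atTop
      (𝓝 0) := by
    have hinv : Tendsto (fun s : ℝ => s⁻¹ * ξ) atTop (𝓝 0) := by
      simpa using tendsto_inv_atTop_zero.mul_const ξ
    simpa using (((continuous_halfFourier hf₀).tendsto 0).comp hinv).const_sub (halfFourier f₀ 0)
  have hlim := ((tendsto_logisticFlow_atTop hnumber).sub (tendsto_logisticFlow_of_tendsto_mul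
    (hmass.tendsto_mul_halfFourier_sub hf₀ ξ) hdefect (one_add_mul_I_ne_zero ξ))).comp
    Real.tendsto_exp_atTop
  rw [one_sub_div_one_add (one_add_mul_I_ne_zero ξ)] at hlim
  refine hlim.congr' ?_
  filter_upwards [eventually_ge_atTop 0] with t ht
  have hchar := h.halfFourier_eq hk ht ((Real.exp t)⁻¹ * ξ)
  rw [mul_inv_cancel_left₀ (Real.exp_ne_zero t)] at hchar
  exact hchar.symm

theorem eq_expProfile_of_isProfile {G : WeightedL1 1} (hG : IsProfile (fun _ _ => 2) G)
    (hmass : IsUnitMassDensity G) : G = expProfile := by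
  refine Lp.ext ((ae_weightMeasure_iff 1).2 (ae_eq_of_halfFourier_eq (G.integrable zero_le_one)
    (expProfile.integrable zero_le_one) (funext fun ξ => ?_)))
  rw [halfFourier_expProfile]
  exact tendsto_nhds_unique tendsto_const_nhds
    (IsMildSolution.tendsto_halfFourier zero_le_one hG hmass ξ)

end Uniqueness

section Nonconcentration

/-- The bump function `(1 + L² (1 - cos y))⁻¹`, with peaks of height one and width of order `L⁻¹`
at the points of `2πℤ`. It detects the mass near these points, which `1 - cos` fails to see. -/
def cosBump (L y : ℝ) : ℝ := (1 + L ^ 2 * (1 - Real.cos y))⁻¹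

theorem mul_one_sub_cos_nonneg (L y : ℝ) : 0 ≤ L ^ 2 * (1 - Real.cos y) :=
  mul_nonneg (sq_nonneg L) (sub_nonneg.2 (Real.cos_le_one y))

theorem cosBump_nonneg (L y : ℝ) : 0 ≤ cosBump L y := by
  have := mul_one_sub_cos_nonneg L y
  rw [cosBump]
  positivity

theorem cosBump_le_one (L y : ℝ) : cosBump L y ≤ 1 :=
  inv_le_one_of_one_le₀ (le_add_of_nonneg_right (mul_one_sub_cos_nonneg L y))

theorem one_le_mul_one_sub_cos_add_cosBump (L y : ℝ) :
    1 ≤ L ^ 2 * (1 - Real.cos y) + cosBump L y := by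
  have hs := mul_one_sub_cos_nonneg L y
  have hinv : (1 + L ^ 2 * (1 - Real.cos y)) * cosBump L y = 1 :=
    mul_inv_cancel₀ (by positivity)
  nlinarith [cosBump_le_one L y]

theorem continuous_cosBump (L : ℝ) : Continuous (cosBump L) := by
  refine Continuous.inv₀ (by fun_prop) fun y => ?_
  have := mul_one_sub_cos_nonneg L y
  positivity

theorem periodic_cosBump (L : ℝ) : Function.Periodic (cosBump L) (2 * Real.pi) := fun y => by
  simp only [cosBump, Real.cos_add_two_pi]

theorem cosBump_le_of_abs_le_pi (L : ℝ) {y : ℝ} (hy : |y| ≤ Real.pi) :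
    cosBump L y ≤ (1 + (L / Real.pi * y) ^ 2)⁻¹ := by
  have hcos : 2 * (y / Real.pi) ^ 2 ≤ 1 - Real.cos y := by
    have := Real.cos_le_one_sub_mul_cos_sq hy
    rw [div_pow]
    linarith [show 2 / Real.pi ^ 2 * y ^ 2 = 2 * (y ^ 2 / Real.pi ^ 2) by ring]
  rw [cosBump, show (L / Real.pi * y) ^ 2 = L ^ 2 * (y / Real.pi) ^ 2 by ring]
  gcongr
  linarith [sq_nonneg (y / Real.pi)]

theorem integral_inv_one_add_mul_sq_le {c : ℝ} (hc : 0 < c) (a b : ℝ) :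
    ∫ y in a..b, (1 + (c * y) ^ 2)⁻¹ ≤ Real.pi / c := by
  rw [intervalIntegral.integral_comp_mul_left (fun y => (1 + y ^ 2)⁻¹) hc.ne',
    integral_inv_one_add_sq, smul_eq_mul, inv_mul_eq_div]
  gcongr
  linarith [Real.arctan_lt_pi_div_two (c * b), Real.neg_pi_div_two_lt_arctan (c * a)]

theorem integral_cosBump_period_le {L : ℝ} (hL : 0 < L) :
    ∫ y in -Real.pi..Real.pi, cosBump L y ≤ 10 / L := by
  have hπ := Real.pi_pos
  calc ∫ y in -Real.pi..Real.pi, cosBump L y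
      ≤ ∫ y in -Real.pi..Real.pi, (1 + (L / Real.pi * y) ^ 2)⁻¹ :=
        intervalIntegral.integral_mono_on (by linarith)
          ((continuous_cosBump L).intervalIntegrable _ _)
          (Continuous.intervalIntegrable (Continuous.inv₀ (by fun_prop) fun y => by positivity) _ _)
          fun y hy => cosBump_le_of_abs_le_pi L (abs_le.2 hy)
    _ ≤ Real.pi / (L / Real.pi) := integral_inv_one_add_mul_sq_le (by positivity) _ _
    _ = Real.pi ^ 2 / L := by field_simp
    _ ≤ 10 / L := by
        gcongr
        nlinarith [Real.pi_lt_d2]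

theorem integral_cosBump_le {L T : ℝ} (hL : 0 < L) (hT : 0 ≤ T) :
    ∫ y in (0 : ℝ)..T, cosBump L y ≤ (T / (2 * Real.pi) + 1) * (10 / L) := by
  have hint := fun a b => (continuous_cosBump L).intervalIntegrable (μ := volume) a b
  set n := ⌈T / (2 * Real.pi)⌉₊
  calc ∫ y in (0 : ℝ)..T, cosBump L y
      ≤ ∫ y in (0 : ℝ)..n * (2 * Real.pi), cosBump L y :=
        intervalIntegral.integral_mono_interval le_rfl hT
          ((div_le_iff₀ Real.two_pi_pos).1 (Nat.le_ceil _)) (ae_of_all _ (cosBump_nonneg L))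
          (hint _ _)
    _ = n * ∫ y in -Real.pi..Real.pi, cosBump L y := by
        have hsum := (periodic_cosBump L).intervalIntegral_add_zsmul_eq n 0 hint
        rw [(periodic_cosBump L).intervalIntegral_add_eq 0 (-Real.pi),
          show -Real.pi + 2 * Real.pi = Real.pi by ring] at hsum
        simpa using hsum
    _ ≤ (T / (2 * Real.pi) + 1) * (10 / L) := by
        refine mul_le_mul (Nat.ceil_lt_add_one (by positivity)).le
          (integral_cosBump_period_le hL) ?_ (by positivity)
        exact intervalIntegral.integral_nonneg (by linarith [Real.pi_pos])
          fun y _ => cosBump_nonneg L y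

theorem integral_cosBump_comp_mul_le {L R η : ℝ} (hL : 0 < L) (hR : 0 ≤ R) (hη : η ≠ 0) :
    ∫ x in (0 : ℝ)..R, cosBump L (η * x) ≤ (R / (2 * Real.pi) + |η|⁻¹) * (10 / L) := by
  have hη' := abs_pos.2 hη
  have heven (x : ℝ) : cosBump L (η * x) = cosBump L (|η| * x) := by
    rcases abs_choice η with h | h <;> simp [h, cosBump]
  simp_rw [heven]
  rw [intervalIntegral.integral_comp_mul_left _ hη'.ne', mul_zero, smul_eq_mul]
  calc |η|⁻¹ * ∫ y in (0 : ℝ)..|η| * R, cosBump L y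
      ≤ |η|⁻¹ * ((|η| * R / (2 * Real.pi) + 1) * (10 / L)) := by
        gcongr
        exact integral_cosBump_le hL (by positivity)
    _ = (R / (2 * Real.pi) + |η|⁻¹) * (10 / L) := by field_simp

theorem integral_cosBump_comp_mul_le_of_inv_le_abs {L B η : ℝ} (hL : 0 < L) (hB : 0 < B)
    (hη : (4 * B)⁻¹ ≤ |η|) : ∫ x in (0 : ℝ)..2 * B, cosBump L (η * x) ≤ 50 * B / L := by
  have hη0 : 0 < |η| := lt_of_lt_of_le (by positivity) hη
  have hlength : 2 * B / (2 * Real.pi) ≤ B := by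
    rw [div_le_iff₀ Real.two_pi_pos]
    nlinarith [Real.pi_gt_three]
  have hperiod : |η|⁻¹ ≤ 4 * B := inv_le_of_inv_le₀ (by positivity) hη
  calc ∫ x in (0 : ℝ)..2 * B, cosBump L (η * x)
      ≤ (2 * B / (2 * Real.pi) + |η|⁻¹) * (10 / L) :=
        integral_cosBump_comp_mul_le hL (by positivity) (abs_pos.1 hη0)
    _ ≤ (B + 4 * B) * (10 / L) := by gcongr
    _ = 50 * B / L := by ring

theorem mul_le_half_mul_sq_add {θ : ℝ} (hθ : 0 < θ) (u v : ℝ) :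
    v * u ≤ θ / 2 * u ^ 2 + (2 * θ)⁻¹ * v ^ 2 := by
  have hsq : 0 ≤ (2 * θ)⁻¹ * (θ * u - v) ^ 2 := by positivity
  have hexp : (2 * θ)⁻¹ * (θ * u - v) ^ 2 = θ / 2 * u ^ 2 + (2 * θ)⁻¹ * v ^ 2 - v * u := by
    field_simp
    ring
  linarith

theorem le_one_sub_cos_add_cosBump_indicator_add {θ R u : ℝ} (L η x : ℝ) (hθ : 0 < θ)
    (hR : 0 < R) (hu : 0 ≤ u) :
    u ≤ L ^ 2 * ((1 - Real.cos (η * x)) * u) + (θ / 2 * u ^ 2 +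
      ((2 * θ)⁻¹ * (Iic R).indicator (fun x => cosBump L (η * x)) x +
        (R ^ 2)⁻¹ * (x ^ 2 * u))) := by
  have hcos := mul_nonneg (mul_one_sub_cos_nonneg L (η * x)) hu
  -- Young's inequality between `u` and the bump for `x ≤ R`, Chebyshev's inequality beyond.
  by_cases hx : x ∈ Iic R
  · rw [indicator_of_mem hx]
    have hsplit := le_mul_of_one_le_left hu (one_le_mul_one_sub_cos_add_cosBump L (η * x))
    have hyoung := mul_le_half_mul_sq_add hθ u (cosBump L (η * x))
    have hbump : (2 * θ)⁻¹ * cosBump L (η * x) ^ 2 ≤ (2 * θ)⁻¹ * cosBump L (η * x) := by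
      gcongr
      exact pow_le_of_le_one (cosBump_nonneg L _) (cosBump_le_one L _) two_ne_zero
    have htail : 0 ≤ (R ^ 2)⁻¹ * (x ^ 2 * u) := by positivity
    linarith
  · rw [indicator_of_notMem hx, mul_zero, zero_add]
    have htail : u ≤ (R ^ 2)⁻¹ * (x ^ 2 * u) := by
      rw [← mul_assoc]
      refine le_mul_of_one_le_left hu ?_
      rw [inv_mul_eq_div, one_le_div (by positivity)]
      exact pow_le_pow_left₀ hR.le (not_le.1 hx).le 2
    have hsq : 0 ≤ θ / 2 * u ^ 2 := by positivity
    linarith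

theorem integrable_one_sub_cos_mul {g : ℝ → ℝ} (hg : Integrable g halfLine) (η : ℝ) :
    Integrable (fun x => (1 - Real.cos (η * x)) * g x) halfLine := by
  refine hg.bdd_mul (c := 2) (Continuous.aestronglyMeasurable (by fun_prop))
    (ae_of_all _ fun x => ?_)
  rw [Real.norm_eq_abs, abs_le]
  constructor <;> linarith [Real.cos_le_one (η * x), Real.neg_one_le_cos (η * x)]

theorem halfLine_restrict_Iic (R : ℝ) : halfLine.restrict (Iic R) = volume.restrict (Ioc 0 R) := by
  rw [halfLine, Measure.restrict_restrict measurableSet_Iic, inter_comm, Ioi_inter_Iic]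

theorem integral_le_one_sub_cos_add_cosBump {g : ℝ → ℝ} (hnonneg : ∀ᵐ x ∂halfLine, 0 ≤ g x)
    (hg : Integrable g halfLine) (hg2 : MemLp g 2 halfLine)
    (hsq : Integrable (fun x => x ^ 2 * g x) halfLine) {θ R : ℝ} (L η : ℝ) (hθ : 0 < θ)
    (hR : 0 < R) :
    ∫ x, g x ∂halfLine ≤ L ^ 2 * ∫ x, (1 - Real.cos (η * x)) * g x ∂halfLine +
      (θ / 2 * ∫ x, g x ^ 2 ∂halfLine + ((2 * θ)⁻¹ * (∫ x in (0 : ℝ)..R, cosBump L (η * x)) +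
        (R ^ 2)⁻¹ * ∫ x, x ^ 2 * g x ∂halfLine)) := by
  set bump := (Iic R).indicator fun x => cosBump L (η * x)
  have hbump : Integrable bump halfLine := by
    rw [integrable_indicator_iff measurableSet_Iic, IntegrableOn, halfLine_restrict_Iic]
    exact ((continuous_cosBump L).comp (continuous_const_mul η)).integrableOn_Ioc
  have hbump_eq : ∫ x, bump x ∂halfLine = ∫ x in (0 : ℝ)..R, cosBump L (η * x) := by
    rw [integral_indicator measurableSet_Iic, halfLine_restrict_Iic,
      intervalIntegral.integral_of_le hR.le]
  have hcos := (integrable_one_sub_cos_mul hg η).const_mul (L ^ 2)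
  have hbump_sq := (hbump.const_mul (2 * θ)⁻¹).add (hsq.const_mul (R ^ 2)⁻¹)
  have hrest := (hg2.integrable_sq.const_mul (θ / 2)).add hbump_sq
  refine (integral_mono_ae hg (hcos.add hrest) ?_).trans_eq ?_
  · filter_upwards [hnonneg] with x hx
    exact le_one_sub_cos_add_cosBump_indicator_add L η x hθ hR hx
  · rw [integral_add' hcos hrest, integral_add' (hg2.integrable_sq.const_mul _) hbump_sq,
      integral_add' (hbump.const_mul _) (hsq.const_mul _), integral_const_mul, integral_const_mul,
      integral_const_mul, integral_const_mul, hbump_eq]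

theorem integral_sq_eq_normL2_sq {g : ℝ → ℝ} (hg2 : MemLp g 2 halfLine) :
    ∫ x, g x ^ 2 ∂halfLine = normL2 g ^ 2 := by
  rw [normL2, ← ENNReal.toReal_pow, eLpNorm_two_sq, integral_eq_lintegral_of_nonneg_ae
    (ae_of_all _ fun x => sq_nonneg _) (hg2.1.pow 2)]
  congr 2 with x
  rw [← ofReal_norm, ← ENNReal.ofReal_pow (norm_nonneg _), Real.norm_eq_abs, sq_abs]

theorem IsUnitMassDensity.two_le_mul_integral_add {g : ℝ → ℝ} (h : IsUnitMassDensity g)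
    (hg : Integrable g halfLine) (hsq : Integrable (fun x => x ^ 2 * g x) halfLine) {c : ℝ}
    (hc : 0 < c) : 2 ≤ c * ∫ x, g x ∂halfLine + c⁻¹ * ∫ x, x ^ 2 * g x ∂halfLine := by
  have hnumber := hg.const_mul c
  have hsecond := hsq.const_mul c⁻¹
  calc 2 = ∫ x, 2 * (x * g x) ∂halfLine := by
        rw [integral_const_mul, h.2.2, mul_one]
    _ ≤ ∫ x, (c * g x + c⁻¹ * (x ^ 2 * g x)) ∂halfLine := by
        refine integral_mono_ae (h.2.1.const_mul 2) (hnumber.add hsecond) ?_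
        filter_upwards [h.1] with x hx
        have hsquare : 0 ≤ c⁻¹ * (c - x) ^ 2 * g x := by positivity
        have hexp : c⁻¹ * (c - x) ^ 2 * g x = c * g x + c⁻¹ * (x ^ 2 * g x) - 2 * (x * g x) := by
          field_simp
          ring
        linarith
    _ = c * ∫ x, g x ∂halfLine + c⁻¹ * ∫ x, x ^ 2 * g x ∂halfLine := by
        rw [integral_add hnumber hsecond, integral_const_mul, integral_const_mul]

/-- Unit mass densities whose moments of order zero and two are at most `B`. -/
structure HasMomentBound (g : ℝ → ℝ) (B : ℝ) : Prop where
  isUnitMassDensity : IsUnitMassDensity g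
  integrable : Integrable g halfLine
  integrable_sq_mul : Integrable (fun x => x ^ 2 * g x) halfLine
  integral_le : ∫ x, g x ∂halfLine ≤ B
  integral_sq_mul_le : ∫ x, x ^ 2 * g x ∂halfLine ≤ B

theorem IsUnitMassDensity.hasMomentBound_normL1 {g : ℝ → ℝ} (h : IsUnitMassDensity g)
    (hg : Integrable g halfLine) (hsq : Integrable (fun x => x ^ 2 * g x) halfLine) :
    HasMomentBound g (normL1 2 g) := by
  have hmass := h.2.1.const_mul 2
  have hsum : normL1 2 g =
      ∫ x, g x ∂halfLine + (2 * ∫ x, x * g x ∂halfLine + ∫ x, x ^ 2 * g x ∂halfLine) := by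
    rw [← integral_const_mul, ← integral_add' hmass hsq, ← integral_add' hg (hmass.add hsq)]
    refine integral_congr_ae ?_
    filter_upwards [h.1] with x hx
    rw [abs_of_nonneg hx, Real.rpow_two, Pi.add_apply, Pi.add_apply]
    ring
  have hnumber : 0 ≤ ∫ x, g x ∂halfLine := integral_nonneg_of_ae h.1
  have hsecond : 0 ≤ ∫ x, x ^ 2 * g x ∂halfLine := by
    refine integral_nonneg_of_ae ?_
    filter_upwards [h.1] with x hx using mul_nonneg (sq_nonneg x) hx
  rw [h.2.2] at hsum
  exact ⟨h, hg, hsq, by linarith, by linarith⟩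

/-- The value of `L` for which the peaks of `cosBump L` are too narrow to carry half of a density
with moments at most `B` and `L²` norm `A`. -/
def concentrationScale (A B : ℝ) : ℝ := 800 * B ^ 3 * (A ^ 2 + 1)

theorem one_le_concentrationScale {B : ℝ} (A : ℝ) (hB : 1 ≤ B) : 1 ≤ concentrationScale A B := by
  have hB3 : 1 ≤ 800 * B ^ 3 := by linarith [one_le_pow₀ hB (n := 3)]
  exact one_le_mul_of_one_le_of_one_le hB3 (by linarith [sq_nonneg A])

namespace HasMomentBound

variable {g : ℝ → ℝ} {B : ℝ}

theorem one_le (h : HasMomentBound g B) : 1 ≤ B := by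
  linarith [h.isUnitMassDensity.two_le_mul_integral_add h.integrable h.integrable_sq_mul one_pos,
    h.integral_le, h.integral_sq_mul_le]

theorem inv_le_integral (h : HasMomentBound g B) : B⁻¹ ≤ ∫ x, g x ∂halfLine := by
  have hB : 0 < B := one_pos.trans_le h.one_le
  have hsecond : B⁻¹ * ∫ x, x ^ 2 * g x ∂halfLine ≤ 1 := by
    rw [inv_mul_le_one₀ hB]
    exact h.integral_sq_mul_le
  rw [inv_le_iff_one_le_mul₀' hB]
  linarith [h.isUnitMassDensity.two_le_mul_integral_add h.integrable h.integrable_sq_mul hB]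

theorem inv_le_integral_one_sub_cos (h : HasMomentBound g B) (hg2 : MemLp g 2 halfLine) {η : ℝ}
    (hη : (4 * B)⁻¹ ≤ |η|) : (2 * B * concentrationScale (normL2 g) B ^ 2)⁻¹ ≤
      ∫ x, (1 - Real.cos (η * x)) * g x ∂halfLine := by
  have hB : 0 < B := one_pos.trans_le h.one_le
  set A := normL2 g
  set L := concentrationScale A B with hL_def
  have hL : 0 < L := one_pos.trans_le (one_le_concentrationScale A h.one_le)
  set θ := (4 * B * (A ^ 2 + 1))⁻¹ with hθ_def
  have hθ : 0 < θ := by positivity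
  have hsplit := integral_le_one_sub_cos_add_cosBump h.isUnitMassDensity.1 h.integrable hg2
    h.integrable_sq_mul L η hθ (R := 2 * B) (by positivity)
  -- The three terms without a cosine carry at most half of the lower bound `B⁻¹` of `∫ g`.
  have hL2 : θ / 2 * ∫ x, g x ^ 2 ∂halfLine ≤ B⁻¹ / 8 := by
    calc θ / 2 * ∫ x, g x ^ 2 ∂halfLine ≤ θ / 2 * (A ^ 2 + 1) := by
          gcongr
          linarith [integral_sq_eq_normL2_sq hg2]
      _ = B⁻¹ / 8 := by
          rw [hθ_def]
          field_simp
          norm_num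
  have hbump : (2 * θ)⁻¹ * ∫ x in (0 : ℝ)..2 * B, cosBump L (η * x) ≤ B⁻¹ / 8 := by
    calc _ ≤ (2 * θ)⁻¹ * (50 * B / L) := by
          gcongr
          exact integral_cosBump_comp_mul_le_of_inv_le_abs hL hB hη
      _ = B⁻¹ / 8 := by
          rw [hθ_def, hL_def, concentrationScale]
          field_simp
          norm_num
  have htail : ((2 * B) ^ 2)⁻¹ * ∫ x, x ^ 2 * g x ∂halfLine ≤ B⁻¹ / 4 := by
    calc ((2 * B) ^ 2)⁻¹ * ∫ x, x ^ 2 * g x ∂halfLine ≤ ((2 * B) ^ 2)⁻¹ * B := by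
          gcongr
          exact h.integral_sq_mul_le
      _ = B⁻¹ / 4 := by
          field_simp
          norm_num
  rw [show (2 * B * L ^ 2)⁻¹ = B⁻¹ / 2 / L ^ 2 by field_simp, div_le_iff₀' (by positivity)]
  linarith [h.inv_le_integral]

end HasMomentBound

end Nonconcentration

section FrequencyEstimates

theorem norm_one_sub_exp_neg_mul_I_le (y : ℝ) :
    ‖1 - Complex.exp (-(y : ℂ) * Complex.I)‖ ≤ |y| := by
  rw [norm_sub_rev, ← Complex.ofReal_neg, mul_comm]
  simpa using Real.norm_exp_I_mul_ofReal_sub_one_le (x := -y)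

theorem norm_one_sub_exp_neg_mul_I_sub_le (y : ℝ) :
    ‖1 - Complex.exp (-(y : ℂ) * Complex.I) - y * Complex.I‖ ≤ 2 * y ^ 2 := by
  rcases le_or_gt |y| 1 with hy | hy
  · have htaylor := Complex.norm_exp_sub_one_sub_id_le (x := -(y : ℂ) * Complex.I)
      (by simpa using hy)
    rw [norm_mul, norm_neg, Complex.norm_I, Complex.norm_real, mul_one, Real.norm_eq_abs, sq_abs,
      ← norm_neg] at htaylor
    refine (le_of_eq ?_).trans (htaylor.trans (by linarith [sq_nonneg y]))
    congr 1
    ring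
  · have htriangle := norm_sub_le (1 - Complex.exp (-(y : ℂ) * Complex.I)) (y * Complex.I)
    rw [norm_mul, Complex.norm_I, Complex.norm_real, mul_one, Real.norm_eq_abs] at htriangle
    nlinarith [sq_abs y, norm_one_sub_exp_neg_mul_I_le y]

theorem integrable_one_sub_exp_mul {g : ℝ → ℝ} (hg : Integrable g halfLine) (η : ℝ) :
    Integrable (fun x => (1 - Complex.exp (-(η * x : ℝ) * Complex.I)) * g x) halfLine := by
  simp only [sub_mul, one_mul]
  exact hg.ofReal.sub (integrable_halfFourier_kernel hg η)

theorem halfFourier_zero_sub {g : ℝ → ℝ} (hg : Integrable g halfLine) (η : ℝ) :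
    halfFourier g 0 - halfFourier g η =
      ∫ x, (1 - Complex.exp (-(η * x : ℝ) * Complex.I)) * g x ∂halfLine := by
  rw [halfFourier_zero, ← integral_complex_ofReal]
  simp only [halfFourier, sub_mul, one_mul]
  exact (integral_sub hg.ofReal (integrable_halfFourier_kernel hg η)).symm

theorem re_halfFourier_zero_sub {g : ℝ → ℝ} (hg : Integrable g halfLine) (η : ℝ) :
    (halfFourier g 0 - halfFourier g η).re =
      ∫ x, (1 - Real.cos (η * x)) * g x ∂halfLine := by
  rw [halfFourier_zero_sub hg]
  refine (integral_re (integrable_one_sub_exp_mul hg η)).symm.trans ?_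
  congr 1 with x
  rw [RCLike.re_eq_complex_re, Complex.re_mul_ofReal, Complex.sub_re, Complex.one_re,
    ← Complex.ofReal_neg, Complex.exp_ofReal_mul_I_re, Real.cos_neg]

theorem re_halfFourier_zero_sub_nonneg {g : ℝ → ℝ} (hnonneg : ∀ᵐ x ∂halfLine, 0 ≤ g x)
    (hg : Integrable g halfLine) (η : ℝ) : 0 ≤ (halfFourier g 0 - halfFourier g η).re := by
  rw [re_halfFourier_zero_sub hg]
  refine integral_nonneg_of_ae ?_
  filter_upwards [hnonneg] with x hx
    using mul_nonneg (sub_nonneg.2 (Real.cos_le_one _)) hx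

theorem IsUnitMassDensity.norm_halfFourier_zero_sub_le {g : ℝ → ℝ} (h : IsUnitMassDensity g)
    (hg : Integrable g halfLine) (η : ℝ) : ‖halfFourier g 0 - halfFourier g η‖ ≤ |η| := by
  rw [halfFourier_zero_sub hg]
  refine (norm_integral_le_of_norm_le (h.2.1.const_mul |η|) ?_).trans_eq
    (by rw [integral_const_mul, h.2.2, mul_one])
  filter_upwards [h.1, ae_halfLine_pos] with x hx hx0
  rw [norm_mul, Complex.norm_real, Real.norm_of_nonneg hx, ← mul_assoc]
  gcongr
  exact (norm_one_sub_exp_neg_mul_I_le (η * x)).trans_eq (by rw [abs_mul, abs_of_pos hx0])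

theorem HasMomentBound.norm_halfFourier_zero_sub_sub_le {g : ℝ → ℝ} {B : ℝ}
    (h : HasMomentBound g B) (η : ℝ) :
    ‖halfFourier g 0 - halfFourier g η - η * Complex.I‖ ≤ 2 * B * η ^ 2 := by
  have hlinear (x : ℝ) :
      ((η * x : ℝ) : ℂ) * Complex.I * g x = η * Complex.I * (x * g x : ℝ) := by
    push_cast
    ring
  have hmass : ∫ x, ((η * x : ℝ) : ℂ) * Complex.I * g x ∂halfLine = η * Complex.I := by
    simp_rw [hlinear]
    rw [integral_const_mul, integral_complex_ofReal, h.isUnitMassDensity.2.2, Complex.ofReal_one,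
      mul_one]
  have hint : Integrable (fun x => ((η * x : ℝ) : ℂ) * Complex.I * g x) halfLine := by
    simp_rw [hlinear]
    exact h.isUnitMassDensity.2.1.ofReal.const_mul _
  rw [halfFourier_zero_sub h.integrable, ← hmass,
    ← integral_sub (integrable_one_sub_exp_mul h.integrable η) hint]
  calc _ ≤ ∫ x, 2 * η ^ 2 * (x ^ 2 * g x) ∂halfLine := by
        refine norm_integral_le_of_norm_le (h.integrable_sq_mul.const_mul (2 * η ^ 2)) ?_
        filter_upwards [h.isUnitMassDensity.1] with x hx
        rw [← sub_mul, norm_mul, Complex.norm_real, Real.norm_of_nonneg hx, ← mul_assoc]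
        gcongr
        exact (norm_one_sub_exp_neg_mul_I_sub_le (η * x)).trans_eq (by ring)
    _ ≤ 2 * η ^ 2 * B := by
        rw [integral_const_mul]
        gcongr
        exact h.integral_sq_mul_le
    _ = 2 * B * η ^ 2 := by ring

theorem one_add_mul_re_le_norm (a : ℝ) (z : ℂ) :
    1 + (a - 1) * z.re ≤ ‖1 + ((a : ℂ) - 1) * z‖ := by
  simpa using Complex.re_le_norm (1 + ((a : ℂ) - 1) * z)

theorem mul_le_norm_one_add_mul {a δ : ℝ} {z : ℂ} (ha : 1 ≤ a) (hδ : δ ≤ 1) (hz : δ ≤ z.re) :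
    a * δ ≤ ‖1 + ((a : ℂ) - 1) * z‖ := by
  refine le_trans ?_ (one_add_mul_re_le_norm a z)
  nlinarith

theorem mul_norm_le_norm_one_add_mul {a : ℝ} {z : ℂ} (ha : 1 ≤ a) (hz : 0 ≤ z.re) :
    (a - 1) * ‖z‖ ≤ ‖1 + ((a : ℂ) - 1) * z‖ := by
  have hre := mul_nonneg (sub_nonneg.2 ha) hz
  refine le_of_sq_le_sq ?_ (norm_nonneg _)
  rw [mul_pow, Complex.sq_norm, Complex.sq_norm, Complex.normSq_apply, Complex.normSq_apply]
  simp only [Complex.add_re, Complex.one_re, Complex.mul_re, Complex.sub_re, Complex.ofReal_re,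
    Complex.sub_im, Complex.ofReal_im, Complex.one_im, sub_zero, zero_mul, Complex.add_im,
    Complex.mul_im, add_zero, zero_add]
  nlinarith

theorem abs_mul_le_norm_one_add_mul_I (a η : ℝ) :
    |a * η| ≤ ‖1 + ((a * η : ℝ) : ℂ) * Complex.I‖ := by
  simpa using Complex.abs_im_le_norm (1 + ((a * η : ℝ) : ℂ) * Complex.I)

theorem norm_logisticFlow_sub_one_le {a δ : ℝ} {z : ℂ} (ha : 1 ≤ a) (hδ : 0 < δ) (hδ1 : δ ≤ 1)
    (hz : δ ≤ z.re) : ‖logisticFlow a z - 1‖ ≤ ‖z - 1‖ / (a * δ) := by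
  have hpos : 0 < a * δ := by positivity
  have hden := mul_le_norm_one_add_mul ha hδ1 hz
  have heq : logisticFlow a z - 1 = (z - 1) / (1 + ((a : ℂ) - 1) * z) := by
    rw [logisticFlow, div_sub_one (norm_pos_iff.1 (hpos.trans_le hden))]
    ring
  rw [heq, norm_div]
  gcongr

theorem norm_logisticFlow_sub_le {a δ ε : ℝ} {z w : ℂ} (ha : 1 ≤ a) (hδ : 0 < δ) (hδ1 : δ ≤ 1)
    (hz : δ ≤ z.re) (hε : 0 < ε) (hε1 : ε ≤ 1) (hw : ε ≤ w.re) :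
    ‖logisticFlow a z - logisticFlow a w‖ ≤ ‖z - w‖ / (a * δ * ε) := by
  have ha0 : 0 < a := one_pos.trans_le ha
  have hz' := mul_le_norm_one_add_mul ha hδ1 hz
  have hw' := mul_le_norm_one_add_mul ha hε1 hw
  have heq : logisticFlow a z - logisticFlow a w =
      a * (z - w) / ((1 + ((a : ℂ) - 1) * z) * (1 + ((a : ℂ) - 1) * w)) := by
    rw [logisticFlow, logisticFlow, div_sub_div _ _
      (norm_pos_iff.1 ((mul_pos ha0 hδ).trans_le hz'))
      (norm_pos_iff.1 ((mul_pos ha0 hε).trans_le hw'))]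
    ring
  rw [heq, norm_div, norm_mul, norm_mul, Complex.norm_real, Real.norm_of_nonneg ha0.le]
  calc a * ‖z - w‖ / (‖1 + ((a : ℂ) - 1) * z‖ * ‖1 + ((a : ℂ) - 1) * w‖)
      ≤ a * ‖z - w‖ / (a * δ * (a * ε)) := by gcongr
    _ = ‖z - w‖ / (a * δ * ε) := by field_simp

theorem logisticFlow_sub_mul_div {a z w : ℂ} (hz : 1 + (a - 1) * z ≠ 0) (hw : 1 + a * w ≠ 0) :
    logisticFlow a z - a * w / (1 + a * w) =
      a * (z - w + w * z) / ((1 + (a - 1) * z) * (1 + a * w)) := by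
  rw [logisticFlow, div_sub_div _ _ hz hw]
  ring

theorem mul_abs_div_three_le_norm_one_add_mul {a B η : ℝ} {φ : ℂ} (ha : 1 ≤ a) (hre : 0 ≤ φ.re)
    (htaylor : ‖φ - η * Complex.I‖ ≤ 2 * B * η ^ 2) (hη : 4 * B * |η| ≤ 1) (hη1 : |η| ≤ 1) :
    a * |η| / 3 ≤ ‖1 + ((a : ℂ) - 1) * φ‖ := by
  have hη0 := abs_nonneg η
  have hone : 1 ≤ ‖1 + ((a : ℂ) - 1) * φ‖ :=
    le_trans (by nlinarith) (one_add_mul_re_le_norm a φ)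
  have hlinear := mul_norm_le_norm_one_add_mul ha hre
  have hφ : |η| / 2 ≤ ‖φ‖ := by
    have htriangle := norm_sub_norm_le (η * Complex.I : ℂ) φ
    rw [norm_mul, Complex.norm_I, mul_one, Complex.norm_real, Real.norm_eq_abs,
      norm_sub_rev] at htriangle
    have hquadratic : 2 * B * η ^ 2 ≤ |η| / 2 := by
      rw [← sq_abs]
      nlinarith [mul_le_mul_of_nonneg_right hη hη0]
    linarith
  nlinarith

theorem norm_logisticFlow_sub_mul_I_div_le {a B η : ℝ} {φ : ℂ} (ha : 1 ≤ a) (hB : 1 ≤ B)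
    (hre : 0 ≤ φ.re) (hφ : ‖φ‖ ≤ |η|) (htaylor : ‖φ - η * Complex.I‖ ≤ 2 * B * η ^ 2)
    (hη : |η| ≤ (4 * B)⁻¹) :
    ‖logisticFlow a φ - (a * η : ℝ) * Complex.I / (1 + (a * η : ℝ) * Complex.I)‖ ≤ 9 * B / a := by
  have ha0 : 0 < a := one_pos.trans_le ha
  have hη0 := abs_nonneg η
  have hBη : 4 * B * |η| ≤ 1 := (le_inv_mul_iff₀ (by positivity)).1 (by simpa using hη)
  have hone : 1 ≤ ‖1 + ((a : ℂ) - 1) * φ‖ :=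
    le_trans (by nlinarith) (one_add_mul_re_le_norm a φ)
  have hden := mul_abs_div_three_le_norm_one_add_mul ha hre htaylor hBη (by nlinarith)
  have hprofile : a * |η| ≤ ‖1 + ((a * η : ℝ) : ℂ) * Complex.I‖ := by
    simpa only [abs_mul, abs_of_pos ha0] using abs_mul_le_norm_one_add_mul_I a η
  have hnum : ‖φ - η * Complex.I + η * Complex.I * φ‖ ≤ 3 * B * η ^ 2 := by
    have hquadratic : ‖(η * Complex.I * φ : ℂ)‖ ≤ η ^ 2 := by
      rw [norm_mul, norm_mul, Complex.norm_I, Complex.norm_real, mul_one, Real.norm_eq_abs,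
        ← sq_abs, sq]
      gcongr
    refine (norm_add_le _ _).trans ?_
    nlinarith [sq_nonneg η]
  have hne := norm_pos_iff.1 (one_pos.trans_le hone)
  have hne' := one_add_mul_I_ne_zero (a * η)
  have heq := logisticFlow_sub_mul_div hne (w := η * Complex.I)
    (by rwa [← mul_assoc, ← Complex.ofReal_mul])
  rw [← mul_assoc, ← Complex.ofReal_mul] at heq
  rw [heq, norm_div, norm_mul, norm_mul, Complex.norm_real, Real.norm_of_nonneg ha0.le,
    div_le_iff₀ (mul_pos (norm_pos_iff.2 hne) (norm_pos_iff.2 hne'))]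
  calc a * ‖φ - η * Complex.I + η * Complex.I * φ‖ ≤ a * (3 * B * η ^ 2) := by gcongr
    _ = 9 * B / a * (a * |η| / 3 * (a * |η|)) := by
        rw [← sq_abs η]
        field_simp
        ring
    _ ≤ _ := by gcongr

theorem norm_logisticFlow_sub_profile_le_of_low {a m B η : ℝ} {φ : ℂ} (ha : 1 ≤ a) (hB : 1 ≤ B)
    (hm : B⁻¹ ≤ m) (hm' : m ≤ B) (hre : 0 ≤ φ.re) (hφ : ‖φ‖ ≤ |η|)
    (htaylor : ‖φ - η * Complex.I‖ ≤ 2 * B * η ^ 2) (hη : |η| ≤ (4 * B)⁻¹) :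
    ‖logisticFlow a m - logisticFlow a φ - (1 + (a * η : ℝ) * Complex.I)⁻¹‖ ≤
      10 * B ^ 2 / a := by
  have hm0 : 0 < m := lt_of_lt_of_le (by positivity) hm
  have hnumber : ‖logisticFlow a m - 1‖ ≤ B ^ 2 / a := by
    refine (norm_logisticFlow_sub_one_le ha (by positivity) (inv_le_one_of_one_le₀ hB)
      (by simpa using hm)).trans ?_
    calc ‖(m : ℂ) - 1‖ / (a * B⁻¹) ≤ B / (a * B⁻¹) := by
          gcongr
          rw [← Complex.ofReal_one, ← Complex.ofReal_sub, Complex.norm_real, Real.norm_eq_abs,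
            abs_le]
          constructor <;> linarith
      _ = B ^ 2 / a := by field_simp
  rw [← one_sub_div_one_add (one_add_mul_I_ne_zero (a * η)), sub_sub_sub_comm]
  calc _ ≤ B ^ 2 / a + 9 * B / a := (norm_sub_le _ _).trans
        (add_le_add hnumber (norm_logisticFlow_sub_mul_I_div_le ha hB hre hφ htaylor hη))
    _ ≤ 10 * B ^ 2 / a := by
        rw [← add_div]
        gcongr
        nlinarith

theorem norm_logisticFlow_sub_profile_le_of_high {a B η δ : ℝ} {m φ : ℂ} (ha : 1 ≤ a) (hB : 1 ≤ B)
    (hm : B⁻¹ ≤ m.re) (hδ : 0 < δ) (hδ1 : δ ≤ 1) (hre : δ ≤ φ.re) (hη : η ≠ 0) :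
    ‖logisticFlow a m - logisticFlow a φ - (1 + (a * η : ℝ) * Complex.I)⁻¹‖ ≤
      (B / δ * ‖m - φ‖ + |η|⁻¹) / a := by
  have ha0 : 0 < a := one_pos.trans_le ha
  have hprofile : ‖(1 + ((a * η : ℝ) : ℂ) * Complex.I)⁻¹‖ ≤ (a * |η|)⁻¹ := by
    rw [norm_inv]
    gcongr
    simpa only [abs_mul, abs_of_pos ha0] using abs_mul_le_norm_one_add_mul_I a η
  calc _ ≤ ‖m - φ‖ / (a * B⁻¹ * δ) + (a * |η|)⁻¹ := (norm_sub_le _ _).trans (add_le_add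
        (norm_logisticFlow_sub_le ha (by positivity) (inv_le_one_of_one_le₀ hB) hm hδ hδ1 hre)
        hprofile)
    _ = (B / δ * ‖m - φ‖ + |η|⁻¹) / a := by field_simp

theorem one_le_two_mul_inv_one_add_sq {η : ℝ} (hη : |η| ≤ 1) : 1 ≤ 2 * (1 + η ^ 2)⁻¹ := by
  rw [← div_eq_mul_inv, one_le_div (by positivity)]
  linarith [(sq_le_one_iff_abs_le_one η).2 hη]

theorem inv_abs_sq_le_mul_inv_one_add_sq {B η : ℝ} (hB : 1 ≤ B) (hη : (4 * B)⁻¹ ≤ |η|) :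
    |η|⁻¹ ^ 2 ≤ 17 * B ^ 2 * (1 + η ^ 2)⁻¹ := by
  have hη0 : 0 < |η| := lt_of_lt_of_le (by positivity) hη
  have hBη : 1 ≤ (4 * B * |η|) ^ 2 :=
    one_le_pow₀ ((inv_le_iff_one_le_mul₀' (by positivity)).1 hη)
  rw [inv_pow, ← div_eq_mul_inv, le_div_iff₀ (by positivity), ← sq_abs η, inv_mul_eq_div,
    div_le_iff₀ (by positivity)]
  nlinarith [one_le_pow₀ hB (n := 2), sq_nonneg |η|]

section HasMomentBound

variable {g : ℝ → ℝ} {a B : ℝ}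

theorem HasMomentBound.norm_logisticFlow_sub_profile_le_of_low (h : HasMomentBound g B)
    (ha : 1 ≤ a) {η : ℝ} (hη : |η| ≤ (4 * B)⁻¹) :
    ‖logisticFlow a (halfFourier g 0) - logisticFlow a (halfFourier g 0 - halfFourier g η) -
      (1 + (a * η : ℝ) * Complex.I)⁻¹‖ ≤ 10 * B ^ 2 / a := by
  rw [halfFourier_zero]
  simpa only [halfFourier_zero] using _root_.norm_logisticFlow_sub_profile_le_of_low ha h.one_le
    h.inv_le_integral h.integral_le
    (re_halfFourier_zero_sub_nonneg h.isUnitMassDensity.1 h.integrable η)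
    (h.isUnitMassDensity.norm_halfFourier_zero_sub_le h.integrable η)
    (h.norm_halfFourier_zero_sub_sub_le η) hη

theorem HasMomentBound.norm_logisticFlow_sub_profile_le_of_high (h : HasMomentBound g B)
    (hg2 : MemLp g 2 halfLine) (ha : 1 ≤ a) {η : ℝ} (hη : (4 * B)⁻¹ ≤ |η|) :
    ‖logisticFlow a (halfFourier g 0) - logisticFlow a (halfFourier g 0 - halfFourier g η) -
      (1 + (a * η : ℝ) * Complex.I)⁻¹‖ ≤
      (2 * B ^ 2 * concentrationScale (normL2 g) B ^ 2 * ‖halfFourier g η‖ + |η|⁻¹) / a := by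
  have hB := h.one_le
  set L := concentrationScale (normL2 g) B
  have hL : 1 ≤ L := one_le_concentrationScale _ hB
  have hnumber : B⁻¹ ≤ (halfFourier g 0).re := by
    rw [halfFourier_zero, Complex.ofReal_re]
    exact h.inv_le_integral
  have hre := h.inv_le_integral_one_sub_cos hg2 hη
  rw [← re_halfFourier_zero_sub h.integrable] at hre
  refine (_root_.norm_logisticFlow_sub_profile_le_of_high ha hB hnumber (by positivity)
    (inv_le_one_of_one_le₀ (by nlinarith [one_le_pow₀ (n := 2) hL])) hre
    (abs_pos.1 (lt_of_lt_of_le (by positivity) hη))).trans_eq ?_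
  rw [sub_sub_cancel, div_inv_eq_mul]
  ring

theorem HasMomentBound.sq_norm_logisticFlow_sub_profile_le (h : HasMomentBound g B)
    (hg2 : MemLp g 2 halfLine) (ha : 1 ≤ a) (η : ℝ) :
    ‖logisticFlow a (halfFourier g 0) - logisticFlow a (halfFourier g 0 - halfFourier g η) -
      (1 + (a * η : ℝ) * Complex.I)⁻¹‖ ^ 2 ≤ (200 * B ^ 4 * (1 + η ^ 2)⁻¹ +
        8 * B ^ 4 * concentrationScale (normL2 g) B ^ 4 * ‖halfFourier g η‖ ^ 2) / a ^ 2 := by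
  have hB := h.one_le
  rcases le_total |η| (4 * B)⁻¹ with hη | hη
  · refine (pow_le_pow_left₀ (norm_nonneg _)
      (h.norm_logisticFlow_sub_profile_le_of_low ha hη) 2).trans ?_
    have hbounded := one_le_two_mul_inv_one_add_sq
      (hη.trans (inv_le_one_of_one_le₀ (by linarith)))
    rw [div_pow]
    gcongr
    refine le_add_of_le_of_nonneg ?_ (by positivity)
    nlinarith [pow_pos (one_pos.trans_le hB) 4]
  · refine (pow_le_pow_left₀ (norm_nonneg _)
      (h.norm_logisticFlow_sub_profile_le_of_high hg2 ha hη) 2).trans ?_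
    set L := concentrationScale (normL2 g) B
    rw [div_pow]
    gcongr
    calc (2 * B ^ 2 * L ^ 2 * ‖halfFourier g η‖ + |η|⁻¹) ^ 2
        ≤ 2 * ((2 * B ^ 2 * L ^ 2 * ‖halfFourier g η‖) ^ 2 + |η|⁻¹ ^ 2) := add_sq_le
      _ ≤ 2 * ((2 * B ^ 2 * L ^ 2 * ‖halfFourier g η‖) ^ 2 + 100 * B ^ 4 * (1 + η ^ 2)⁻¹) := by
          gcongr
          refine (inv_abs_sq_le_mul_inv_one_add_sq hB hη).trans ?_
          gcongr <;> norm_num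
      _ = _ := by ring

end HasMomentBound

end FrequencyEstimates

section Rate

theorem lintegral_inv_one_add_sq_add_halfFourier_sq {g : ℝ → ℝ} (hg : Integrable g halfLine)
    (hg2 : MemLp g 2 halfLine) {K₁ K₂ : ℝ} (hK₁ : 0 ≤ K₁) (hK₂ : 0 ≤ K₂) :
    ∫⁻ η, ENNReal.ofReal (K₁ * (1 + η ^ 2)⁻¹ + K₂ * ‖halfFourier g η‖ ^ 2) =
      ENNReal.ofReal (2 * Real.pi * (K₁ / 2 + K₂ * normL2 g ^ 2)) := by
  have hmeas : Measurable fun η => ‖halfFourier g η‖ₑ ^ 2 :=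
    (continuous_halfFourier hg).enorm.measurable.pow_const 2
  have hsplit (η : ℝ) : ENNReal.ofReal (K₁ * (1 + η ^ 2)⁻¹ + K₂ * ‖halfFourier g η‖ ^ 2) =
      ENNReal.ofReal (K₁ * (1 + η ^ 2)⁻¹) + ENNReal.ofReal K₂ * ‖halfFourier g η‖ₑ ^ 2 := by
    rw [ENNReal.ofReal_add (by positivity) (by positivity), ENNReal.ofReal_mul hK₂,
      ENNReal.ofReal_pow (norm_nonneg _), ofReal_norm]
  have hlorentz : ∫⁻ η : ℝ, ENNReal.ofReal (K₁ * (1 + η ^ 2)⁻¹) =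
      ENNReal.ofReal (K₁ * Real.pi) := by
    rw [← ofReal_integral_eq_lintegral_ofReal (integrable_inv_one_add_sq.const_mul _)
      (ae_of_all _ fun η => by positivity), integral_const_mul, integral_univ_inv_one_add_sq]
  have hplancherel : ∫⁻ η, ‖halfFourier g η‖ₑ ^ 2 =
      ENNReal.ofReal (2 * Real.pi * normL2 g ^ 2) := by
    rw [lintegral_halfFourier_sq hg, ← ENNReal.ofReal_toReal hg2.2.ne, normL2,
      ← ENNReal.ofReal_pow ENNReal.toReal_nonneg, ← ENNReal.ofReal_mul (by positivity)]
  simp_rw [hsplit]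
  rw [lintegral_add_right _ (hmeas.const_mul _), lintegral_const_mul _ hmeas, hlorentz, hplancherel,
    ← ENNReal.ofReal_mul hK₂, ← ENNReal.ofReal_add (by positivity) (by positivity)]
  congr 1
  ring

theorem eLpNorm_sq_le_of_sq_norm_halfFourier_le {u g : ℝ → ℝ} (hu : Integrable u halfLine)
    (hg : Integrable g halfLine) (hg2 : MemLp g 2 halfLine) {a K₁ K₂ : ℝ} (ha : 0 < a)
    (hK₁ : 0 ≤ K₁) (hK₂ : 0 ≤ K₂)
    (h : ∀ η, ‖halfFourier u (a * η)‖ ^ 2 ≤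
      (K₁ * (1 + η ^ 2)⁻¹ + K₂ * ‖halfFourier g η‖ ^ 2) / a ^ 2) :
    eLpNorm u 2 halfLine ^ 2 ≤ ENNReal.ofReal ((K₁ / 2 + K₂ * normL2 g ^ 2) / a) := by
  have hpointwise (η : ℝ) : ‖halfFourier u (a * η)‖ₑ ^ 2 ≤ ENNReal.ofReal (a ^ 2)⁻¹ *
      ENNReal.ofReal (K₁ * (1 + η ^ 2)⁻¹ + K₂ * ‖halfFourier g η‖ ^ 2) := by
    rw [← ofReal_norm, ← ENNReal.ofReal_pow (norm_nonneg _), ← ENNReal.ofReal_mul (by positivity),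
      inv_mul_eq_div]
    exact ENNReal.ofReal_le_ofReal (h η)
  have hle : ENNReal.ofReal (2 * Real.pi) * eLpNorm u 2 halfLine ^ 2 ≤
      ENNReal.ofReal (2 * Real.pi) * ENNReal.ofReal ((K₁ / 2 + K₂ * normL2 g ^ 2) / a) := by
    calc ENNReal.ofReal (2 * Real.pi) * eLpNorm u 2 halfLine ^ 2
        = ENNReal.ofReal a * ∫⁻ η, ‖halfFourier u (a * η)‖ₑ ^ 2 := by
          rw [← lintegral_halfFourier_sq hu, ← ofReal_abs_mul_lintegral_comp_mul_left _ ha.ne',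
            abs_of_pos ha]
      _ ≤ ENNReal.ofReal a * (ENNReal.ofReal (a ^ 2)⁻¹ *
            ENNReal.ofReal (2 * Real.pi * (K₁ / 2 + K₂ * normL2 g ^ 2))) := by
          rw [← lintegral_inv_one_add_sq_add_halfFourier_sq hg hg2 hK₁ hK₂,
            ← lintegral_const_mul' (ENNReal.ofReal (a ^ 2)⁻¹) _ ENNReal.ofReal_ne_top]
          exact mul_le_mul' le_rfl (lintegral_mono hpointwise)
      _ = _ := by
          rw [← ENNReal.ofReal_mul (by positivity), ← ENNReal.ofReal_mul ha.le,
            ← ENNReal.ofReal_mul (by positivity)]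
          congr 1
          field_simp
  exact (ENNReal.mul_le_mul_iff_right (by simpa using Real.pi_pos) ENNReal.ofReal_ne_top).1 hle

/-- The constant of the exponential convergence, for data with `L²` norm `A` and moments at
most `B`. -/
def rateConstant (A B : ℝ) : ℝ :=
  1 + 100 * B ^ 4 + 8 * B ^ 4 * concentrationScale A B ^ 4 * A ^ 2

/-- The square of a closed formula. -/
def ExplicitFormula.square (u : ExplicitFormula) : ExplicitFormula := .mul u u

/-- The closed formula of `concentrationScale`. -/
def scaleFormula : ExplicitFormula :=
  .mul (.mul (.const 800) (.mul .b (.square .b))) (.add (.square .a) (.const 1))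

/-- The closed formula of `rateConstant`. -/
def rateFormula : ExplicitFormula :=
  .add (.add (.const 1) (.mul (.const 100) (.square (.square .b))))
    (.mul (.mul (.mul (.const 8) (.square (.square .b))) (.square (.square scaleFormula)))
      (.square .a))

theorem ExplicitFormula.eval_square (u : ExplicitFormula) (A B : ℝ) :
    u.square.eval A B = u.eval A B ^ 2 := (sq _).symm

theorem eval_rateFormula (A B : ℝ) : rateFormula.eval A B = rateConstant A B := by
  simp only [rateFormula, scaleFormula, ExplicitFormula.eval_square, ExplicitFormula.eval,
    rateConstant, concentrationScale]
  push_cast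
  ring

theorem one_le_rateConstant (A B : ℝ) : 1 ≤ rateConstant A B := by
  rw [rateConstant, add_assoc]
  exact le_add_of_nonneg_right (by positivity)

theorem rateConstant_mono {A A' B B' : ℝ} (hA : 0 ≤ A) (hAA' : A ≤ A') (hB : 0 ≤ B)
    (hBB' : B ≤ B') : rateConstant A B ≤ rateConstant A' B' := by
  have hB' := hB.trans hBB'
  unfold rateConstant concentrationScale
  gcongr

variable {k : ℝ} {f₀ : WeightedL1 k} {f : ℝ → WeightedL1 k} {B : ℝ}

theorem IsMildSolution.sq_norm_halfFourier_sub_expProfile_le (hk : 0 ≤ k)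
    (h : IsMildSolution (fun _ _ => 2) f₀ f) (hB : HasMomentBound f₀ B)
    (hf₀ : MemLp f₀ 2 halfLine) {t : ℝ} (ht : 0 ≤ t) (η : ℝ) :
    ‖halfFourier (fun x => f t x - expProfile x) (Real.exp t * η)‖ ^ 2 ≤
      (200 * B ^ 4 * (1 + η ^ 2)⁻¹ + 8 * B ^ 4 * concentrationScale (normL2 f₀) B ^ 4 *
        ‖halfFourier f₀ η‖ ^ 2) / Real.exp t ^ 2 := by
  rw [halfFourier_sub ((f t).integrable hk) (expProfile.integrable zero_le_one),
    h.halfFourier_eq hk ht, halfFourier_expProfile]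
  exact hB.sq_norm_logisticFlow_sub_profile_le hf₀ (Real.one_le_exp ht) η

theorem IsMildSolution.eLpNorm_sub_expProfile_le (hk : 0 ≤ k)
    (h : IsMildSolution (fun _ _ => 2) f₀ f) (hB : HasMomentBound f₀ B)
    (hf₀ : MemLp f₀ 2 halfLine) {t : ℝ} (ht : 0 ≤ t) :
    eLpNorm (fun x => f t x - expProfile x) 2 halfLine ≤
      ENNReal.ofReal (rateConstant (normL2 f₀) B * Real.exp (-t / 2)) := by
  have hC := one_le_rateConstant (normL2 f₀) B
  rw [← ENNReal.pow_le_pow_left_iff two_ne_zero, ← ENNReal.ofReal_pow (by positivity)]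
  refine (eLpNorm_sq_le_of_sq_norm_halfFourier_le
    (((f t).integrable hk).sub (expProfile.integrable zero_le_one)) hB.integrable
    hf₀ (Real.exp_pos t) (by positivity) (by positivity)
    (h.sq_norm_halfFourier_sub_expProfile_le hk hB hf₀ ht)).trans (ENNReal.ofReal_le_ofReal ?_)
  calc _ = (rateConstant (normL2 f₀) B - 1) * (Real.exp t)⁻¹ := by
        rw [rateConstant]
        ring
    _ ≤ rateConstant (normL2 f₀) B ^ 2 * (Real.exp t)⁻¹ := by
        gcongr
        nlinarith
    _ = (rateConstant (normL2 f₀) B * Real.exp (-t / 2)) ^ 2 := by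
        rw [mul_pow, ← Real.exp_nat_mul, ← Real.exp_neg]
        congr 2
        push_cast
        ring

end Rate

end

theorem theorem2p9 :
    -- `e^{-x}` is the unique self-similar profile with total mass one, for the kernel `K = 2`
    (∃ G₀ : WeightedL1 1, (G₀ =ᵐ[halfLine] fun x => Real.exp (-x)) ∧
      IsProfile (fun _ _ => 2) G₀ ∧ IsUnitMassDensity G₀ ∧
      ∀ G : WeightedL1 1, IsProfile (fun _ _ => 2) G → IsUnitMassDensity G → G = G₀) ∧
    -- convergence to it, with a constant depending on the two norms of the initial datum only
    ∃ C : ℝ → ℝ → ℝ,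
      (∃ F : ExplicitFormula, ∀ A B : ℝ, 0 ≤ A → 0 ≤ B → C A B = F.eval A B) ∧
      (∀ A B : ℝ, 0 ≤ A → 0 ≤ B → 0 < C A B) ∧
      (∀ A A' B B' : ℝ, 0 ≤ A → A ≤ A' → 0 ≤ B → B ≤ B' → C A B ≤ C A' B') ∧
      ∀ (k : ℝ), 0 ≤ k → ∀ (f₀ : WeightedL1 k) (f : ℝ → WeightedL1 k),
        IsMildSolution (fun _ _ => 2) f₀ f →
        IsUnitMassDensity f₀ →
        MemLp f₀ 2 halfLine →
        Integrable (fun x => x ^ 2 * f₀ x) halfLine →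
        ∀ t : ℝ, 0 ≤ t →
          eLpNorm (fun x => f t x - Real.exp (-x)) 2 halfLine ≤
            ENNReal.ofReal (C (normL2 f₀) (normL1 2 f₀) * Real.exp (-t / 2)) := by
  refine ⟨⟨expProfile, expProfile_ae_eq, isProfile_expProfile, isUnitMassDensity_expProfile,
    fun G => eq_expProfile_of_isProfile⟩, rateConstant,
    ⟨rateFormula, fun A B _ _ => (eval_rateFormula A B).symm⟩,
    fun A B _ _ => one_pos.trans_le (one_le_rateConstant A B),
    fun A A' B B' => rateConstant_mono, fun k hk f₀ f h hmass hf₀ hsq t ht => ?_⟩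
  have hprofile : (fun x => f t x - Real.exp (-x)) =ᵐ[halfLine] fun x => f t x - expProfile x := by
    filter_upwards [expProfile_ae_eq] with x hx
    rw [hx]
  rw [eLpNorm_congr_ae hprofile]
  exact h.eLpNorm_sub_expProfile_le hk (hmass.hasMomentBound_normL1 (f₀.integrable hk) hsq) hf₀ ht
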